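/- **Model.** Let $n\ge 2$, $0\le t\le n-1$, $1\le k\le d$ be integers. There are $n$ synchronous, deterministic processes, communicating in rounds over a complete network; round $m+1$ takes place between times $m$ and $m+1$. An *adversary* $\alpha=(\vec v,\mathsf F)$ consists of an input vector $\vec v\in\{0,\dots,d\}^n$ and a crash failure pattern $\mathsf F$, which says for every round which messages are delivered: a process that loses a message in some round sends nothing in later rounds, and at most $t$ processes ever lose a message. Processes that never lose a message are *correct*. A process is *active* at time $m$ if all its messages of rounds $1,\dots,m$ are delivered. A *protocol* specifies, as deterministic functions of the local state, the messages sent in each round, the state update upon receipt of the round's messages, and the decisions; a process decides (once) at the first time at which its local state prescribes a decision, provided that it is active then. A protocol and an adversary determine a run. A protocol *solves nonuniform $k$-set consensus* if in every run: the correct processes decide on at most $k$ distinct values; every correct process decides; and any value decided upon (by any process) is the initial value of some process. **The protocol.** In the full-information protocol every process sends its whole view to all others in every round; the view of $\langle i,m\rangle$ consists of all nodes $\langle j,\ell\rangle$ (process $j$ at time $\ell$) from which a message chain reaches $\langle i,m\rangle$ (these nodes are *seen*; the chain may stay at one process), the message edges among them that it has learned of, and the initial values it has seen. A node $\langle j,\ell\rangle$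 is *guaranteed crashed* at $\langle i,m\rangle$ if some seen node $\langle p,s\rangle$ with $1\le s\le \ell$ did not hear from $j$ in round $s$; it is *hidden* from $\langle i,m\rangle$ if it is neither seen nor guaranteed crashed. The *hidden capacity* of $\langle i,m\rangle$ is the maximal $c$ such that for each $\ell\le m$ at least $c$ nodes at time $\ell$ are hidden from $\langle i,m\rangle$. Let $\mathrm{Min}\langle i,m\rangle$ be the minimal initial value seen by $\langle i,m\rangle$. The protocol $\mathrm{Opt}_{\min[k]}$ is the full-information protocol in which an undecided process $i$ decides at time $m$ on $\mathrm{Min}\langle i,m\rangle$ if and only if $\mathrm{Min}\langle i,m\rangle<k$ or the hidden capacity of $\langle i,m\rangle$ is less than $k$. **Last-decider unbeatability.** A protocol $Q$ *last-decider dominates* a protocol $P$ if for every adversary $\alpha$, if the last decision in the run of $P$ against $\alpha$ is at time $m$, then all decisions in the run of $Q$ against $\alpha$ are taken at or before time $m$; it does so *strictly* if moreover $P$ does not last-decider dominate $Q$. A protocol $P$ is a *last-decider unbeatable* solution if it solves the task and no protocol $Q$ solving the task strictly last-decider dominates $P$. **Theorem.** $\mathrm{Opt}_{\min[k]}$ is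 a last-decider unbeatable solution to nonuniform $k$-set consensus in the crash failure model with initial values $\{0,\dots,d\}$ and at most $t$ crashes. This holds both when the decisions of all processes are counted in last-decider domination (including those that faulty processes take before they crash) and when only the decisions of correct processes are counted. -/

import Mathlib

namespace SetConsensus

/-- A crash-failure adversary for `n` processes, with initial values in `{0, …, d}` and at most `t`
crashes: an input vector together with a failure pattern, a layered graph on the nodes `⟨i, m⟩`.
`delivered m i j` says that the edge `(⟨i, m⟩, ⟨j, m + 1⟩)` is present: a message sent by `i` to `j`
in round `m + 1` is delivered. Only pairs `i ≠ j` are ever consulted. -/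
structure Adversary (n d t : ℕ) where
  input : Fin n → Fin (d + 1)
  delivered : ℕ → Fin n → Fin n → Prop
  /-- Once some message of `i` is lost in a round, `i` sends nothing in the later rounds. -/
  crash : ∀ i m, (∃ j, j ≠ i ∧ ¬ delivered m i j) →
    ∀ m', m < m' → ∀ j, j ≠ i → ¬ delivered m' i j
  /-- At most `t` processes ever lose a message. -/
  faulty_le : {i | ∃ m j, j ≠ i ∧ ¬ delivered m i j}.ncard ≤ t

namespace Adversary

variable {n d t : ℕ}

/-- The processes that never fail. -/
def correct (α : Adversary n d t) : Set (Fin n) :=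
  {i | ∀ m j, j ≠ i → α.delivered m i j}

/-- Process `i` is active at time `m`: it has not crashed in any of the rounds `1, …, m`. -/
def Active (α : Adversary n d t) (i : Fin n) (m : ℕ) : Prop :=
  ∀ m', m' < m → ∀ j, j ≠ i → α.delivered m' i j

end Adversary

/-- A deterministic synchronous message-passing protocol. At every time a process, as a function of
its local state, possibly decides and chooses the messages (if any) that it sends to the others in
the coming round; the messages received in the round, tagged with their senders, update its local
state. -/
structure Protocol (n d : ℕ) where
  State : Type
  Msg : Type
  init : Fin n → Fin (d + 1) → State
  /-- `send i s j` is what process `i` in state `s` sends to `j`. -/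
  send : Fin n → State → Fin n → Option Msg
  step : Fin n → State → (Fin n → Option Msg) → State
  decision : Fin n → State → Option (Fin (d + 1))

namespace Protocol

variable {n d t : ℕ}

open Classical in
/-- The local states, at time `m`, of the run of `P` against the adversary `α`. -/
noncomputable def state (P : Protocol n d) (α : Adversary n d t) : ℕ → Fin n → P.State
  | 0 => fun i => P.init i (α.input i)
  | m + 1 => fun i => P.step i (state P α m i) (fun j =>
      if j ≠ i ∧ α.delivered m j i then P.send j (state P α m j) i else none)

/-- In the run of `P` against `α`, process `i` decides on `v` at time `m`: it is active then, its
local state prescribes the decision `v`, and it is still undecided. -/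
def Decides (P : Protocol n d) (α : Adversary n d t) (i : Fin n) (m : ℕ) (v : Fin (d + 1)) : Prop :=
  α.Active i m ∧ P.decision i (P.state α m i) = some v ∧
    ∀ m', m' < m → P.decision i (P.state α m' i) = none

/-- `P` solves nonuniform `k`-set consensus when at most `t` processes crash. -/
structure Solves (k t : ℕ) (P : Protocol n d) : Prop where
  agreement : ∀ α : Adversary n d t, {v | ∃ i ∈ α.correct, ∃ m, P.Decides α i m v}.ncard ≤ k
  decision : ∀ α : Adversary n d t, ∀ i ∈ α.correct, ∃ m v, P.Decides α i m v
  validity : ∀ (α : Adversary n d t) i m v, P.Decides α i m v → ∃ j, α.input j = v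

/-- The times at which processes in `S` decide in the run of `P` against `α`. -/
def decisionTimes (P : Protocol n d) (α : Adversary n d t) (S : Set (Fin n)) : Set ℕ :=
  {m | ∃ i ∈ S, ∃ v, P.Decides α i m v}

/-- `Q` last-decider dominates `P`: against every adversary `α`, if the last decision of `P` is at
time `m`, then all decisions of `Q` are taken at or before `m`. Only the decisions of the processes
in `S α` are counted. -/
def LastDeciderDominates (S : Adversary n d t → Set (Fin n)) (Q P : Protocol n d) : Prop :=
  ∀ (α : Adversary n d t) (m : ℕ), IsGreatest (P.decisionTimes α (S α)) m →
    ∀ m' ∈ Q.decisionTimes α (S α), m' ≤ m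

def StrictlyLastDeciderDominates (S : Adversary n d t → Set (Fin n)) (Q P : Protocol n d) : Prop :=
  LastDeciderDominates S Q P ∧ ¬ LastDeciderDominates S P Q

/-- `P` is a last-decider unbeatable solution to nonuniform `k`-set consensus with at most `t`
crashes, where last decisions are taken among the processes in `S α`. -/
def LastDeciderUnbeatable (k t : ℕ) (S : Adversary n d t → Set (Fin n)) (P : Protocol n d) : Prop :=
  P.Solves k t ∧ ∀ Q : Protocol n d, Q.Solves k t → ¬ StrictlyLastDeciderDominates S Q P

end Protocol

/-- A view: a labelled subgraph of the communication graph, belonging to the node `root`. -/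
structure View (n d : ℕ) where
  root : Fin n × ℕ
  nodes : Set (Fin n × ℕ)
  edges : Set ((Fin n × ℕ) × (Fin n × ℕ))
  /-- `(j, v)` is present when the initial node `⟨j, 0⟩` carries the initial value `v`. -/
  labels : Set (Fin n × Fin (d + 1))

namespace View

variable {n d : ℕ}

/-- The view of process `i` at time `0`. -/
def initial (i : Fin n) (v : Fin (d + 1)) : View n d where
  root := (i, 0)
  nodes := {(i, 0)}
  edges := ∅
  labels := {(i, v)}

/-- The view of process `i`, whose view so far is `g`, after a round in which it receives the views
`msgs`: the new node `⟨i, m + 1⟩`, the union of `g` and all the views received, and the edges into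
the new node from `i` itself and from all the processes heard from. -/
def extend (i : Fin n) (g : View n d) (msgs : Fin n → Option (View n d)) : View n d where
  root := (i, g.root.2 + 1)
  nodes := {(i, g.root.2 + 1)} ∪ g.nodes ∪ {x | ∃ j h, msgs j = some h ∧ x ∈ h.nodes}
  edges := {e | ∃ j, (j = i ∨ (msgs j).isSome) ∧ e = ((j, g.root.2), (i, g.root.2 + 1))} ∪
    g.edges ∪ {e | ∃ j h, msgs j = some h ∧ e ∈ h.edges}
  labels := g.labels ∪ {x | ∃ j h, msgs j = some h ∧ x ∈ h.labels}

def Seen (g : View n d) (j : Fin n) (l : ℕ) : Prop := (j, l) ∈ g.nodes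

/-- The view proves that `j` crashed before time `l`: some node `⟨p, s + 1⟩` with `s + 1 ≤ l` in the
view did not hear from `j` in round `s + 1`. -/
def GuaranteedCrashed (g : View n d) (j : Fin n) (l : ℕ) : Prop :=
  ∃ (p : Fin n) (s : ℕ), (p, s + 1) ∈ g.nodes ∧ s + 1 ≤ l ∧ ((j, s), (p, s + 1)) ∉ g.edges

def Hidden (g : View n d) (j : Fin n) (l : ℕ) : Prop :=
  ¬ g.Seen j l ∧ ¬ g.GuaranteedCrashed j l

/-- The largest `c` such that at each time `l ≤ m`, where `m` is the time of the view, there are `c`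
distinct hidden nodes. -/
noncomputable def hiddenCapacity (g : View n d) : ℕ :=
  sSup {c | ∀ l, l ≤ g.root.2 → ∃ A : Finset (Fin n), A.card = c ∧ ∀ j ∈ A, g.Hidden j l}

/-- The initial values seen. -/
def vals (g : View n d) : Set (Fin (d + 1)) := {v | ∃ j, (j, v) ∈ g.labels}

/-- The minimal initial value seen. -/
noncomputable def minVal (g : View n d) : Fin (d + 1) := sInf g.vals

/-- A value smaller than `k` has been seen. -/
def Low (k : ℕ) (g : View n d) : Prop := (g.minVal : ℕ) < k

end View

/-- The full-information protocol with the given decision rule: the local state is the view, and it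
is sent to all the others in every round. -/
def fullInformation {n d : ℕ} (rule : View n d → Option (Fin (d + 1))) : Protocol n d where
  State := View n d
  Msg := View n d
  init := View.initial
  send := fun _ g _ => some g
  step := View.extend
  decision := fun _ g => rule g

open Classical in
/-- The protocol `Opt_min[k]`: an undecided process that is low or has hidden capacity less than `k`
decides on the minimal value that it has seen. -/
noncomputable def optMin (n d k : ℕ) : Protocol n d :=
  fullInformation fun g => if g.Low k ∨ g.hiddenCapacity < k then some g.minVal else none

end SetConsensus

/-! Let `Q` solve the task and last-decider dominate `optMin`. Whenever a process decides under
`optMin`, it decides under `Q` at exactly the same time, so `optMin` dominates `Q` back. Not later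
(`exists_decision_of_ready`): given an active node at which `optMin` is ready to decide, change the
last round so that every sender reaches either everybody or nobody, according to whether it reached
this node. The node notices nothing, its process is now correct, and all active processes are ready
too. So `optMin` has finished by then, and domination forces `Q` to have decided at this node. In
particular `Q` has decided wherever a value below `k` is seen (`DecidesLow`). Not earlier
(`DecidesLow.undecided`): suppose that `⟨i, m⟩` sees no low value and that `k` nodes are hidden from
it at each time. These nodes form `k` disjoint chains, and it is consistent with the view of `i`
that chain `c` secretly carries the value `c`. By induction along the chains the member at time `l`
decides on `c`, while processes that no chain reaches stay undecided. The crucial step is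
`Chains.Invariant.decision_lt`: if a process could decide on a value at least `k`, the Hall-type
lemma `exists_rainbow` would produce one run in which correct processes decide on values of all `k +
1` colours. That `optMin` itself is a solution is `optMin_solves`. -/

namespace SetConsensus

variable {n d t : ℕ}

/-! ### Seen and hidden nodes. -/

namespace Adversary

/-- The nodes seen by `⟨i, m⟩`: those from which a message chain reaches it. -/
def seen (α : Adversary n d t) : ℕ → Fin n → Set (Fin n × ℕ)
  | 0, i => {(i, 0)}
  | m + 1, i => {(i, m + 1)} ∪ seen α m i ∪
      {x | ∃ j, (j ≠ i ∧ α.delivered m j i) ∧ x ∈ seen α m j}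

theorem mem_seen_succ {α : Adversary n d t} {m : ℕ} {i : Fin n} {x : Fin n × ℕ} :
    x ∈ α.seen (m + 1) i ↔ x = (i, m + 1) ∨ x ∈ α.seen m i ∨
      ∃ j, (j ≠ i ∧ α.delivered m j i) ∧ x ∈ α.seen m j := by
  simp only [seen, Set.mem_union, Set.mem_singleton_iff, Set.mem_ofPred_eq, or_assoc]

theorem le_of_mem_seen {α : Adversary n d t} {m s : ℕ} {i j : Fin n}
    (h : (j, s) ∈ α.seen m i) : s ≤ m := by
  induction m generalizing i with
  | zero => simp only [seen, Set.mem_singleton_iff, Prod.mk.injEq] at h; omega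
  | succ m ih =>
    rcases mem_seen_succ.1 h with h | h | ⟨p, -, h⟩
    · simp only [Prod.mk.injEq] at h; omega
    · exact (ih h).trans m.le_succ
    · exact (ih h).trans m.le_succ

theorem self_mem_seen (α : Adversary n d t) {m s : ℕ} (i : Fin n) (h : s ≤ m) :
    (i, s) ∈ α.seen m i := by
  induction m with
  | zero => obtain rfl : s = 0 := by omega
            simp [seen]
  | succ m ih =>
    rcases h.eq_or_lt with rfl | h
    · exact mem_seen_succ.2 (Or.inl rfl)
    · exact mem_seen_succ.2 (Or.inr (Or.inl (ih (by omega))))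

theorem eq_of_mem_seen_self {α : Adversary n d t} {m : ℕ} {i j : Fin n}
    (h : (j, m) ∈ α.seen m i) : j = i := by
  cases m with
  | zero => simpa [seen] using h
  | succ m =>
    rcases mem_seen_succ.1 h with h | h | ⟨p, -, h⟩
    · exact congrArg Prod.fst h
    · exact absurd (le_of_mem_seen h) (by omega)
    · exact absurd (le_of_mem_seen h) (by omega)

theorem seen_subset {α : Adversary n d t} {m s : ℕ} {i j : Fin n}
    (h : (j, s) ∈ α.seen m i) : α.seen s j ⊆ α.seen m i := by
  induction m generalizing i with
  | zero =>
    simp only [seen, Set.mem_singleton_iff, Prod.mk.injEq] at h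
    obtain ⟨rfl, rfl⟩ := h
    exact subset_rfl
  | succ m ih =>
    rcases mem_seen_succ.1 h with h | h | ⟨p, hp, h⟩
    · obtain ⟨rfl, rfl⟩ := Prod.mk.inj h
      exact subset_rfl
    · exact fun x hx => mem_seen_succ.2 (Or.inr (Or.inl (ih h hx)))
    · exact fun x hx => mem_seen_succ.2 (Or.inr (Or.inr ⟨p, hp, ih h hx⟩))

theorem mem_seen_of_succ_mem {α : Adversary n d t} {m s : ℕ} {i j : Fin n}
    (h : (j, s + 1) ∈ α.seen m i) : (j, s) ∈ α.seen m i :=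
  seen_subset h (α.self_mem_seen j s.le_succ)

theorem mem_seen_of_delivered {α : Adversary n d t} {m s : ℕ} {i j p : Fin n}
    (h : (p, s + 1) ∈ α.seen m i) (hjp : j ≠ p) (hd : α.delivered s j p) :
    (j, s) ∈ α.seen m i :=
  seen_subset h (mem_seen_succ.2 (Or.inr (Or.inr ⟨j, ⟨hjp, hd⟩, α.self_mem_seen j le_rfl⟩)))

theorem active_of_delivered {α : Adversary n d t} {m : ℕ} {i j : Fin n} (hji : j ≠ i)
    (h : α.delivered m j i) : α.Active j m := by
  intro m' hm' p hp
  by_contra hn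
  exact α.crash j m' ⟨p, hp, hn⟩ m hm' i hji.symm h

theorem Active.mono {α : Adversary n d t} {m m' : ℕ} {i : Fin n} (h : α.Active i m)
    (hm : m' ≤ m) : α.Active i m' := fun s hs => h s (hs.trans_le hm)

theorem active_of_mem_correct {α : Adversary n d t} {i : Fin n} (h : i ∈ α.correct) (m : ℕ) :
    α.Active i m := fun s _ => h s

/-- A message chain into `⟨i, m⟩` passes at every intermediate time through a process that is `i`
or still active. -/
theorem exists_mem_seen_between {α : Adversary n d t} {m l s : ℕ} {i x : Fin n}
    (h : (x, s) ∈ α.seen m i) (hsl : s ≤ l) (hlm : l ≤ m) :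
    ∃ y, (y, l) ∈ α.seen m i ∧ (x, s) ∈ α.seen l y ∧ (y = i ∨ α.Active y l) := by
  induction m generalizing i with
  | zero =>
    obtain rfl : l = 0 := by omega
    exact ⟨i, α.self_mem_seen i le_rfl, h, Or.inl rfl⟩
  | succ m ih =>
    rcases hlm.eq_or_lt with rfl | hlm
    · exact ⟨i, α.self_mem_seen i le_rfl, h, Or.inl rfl⟩
    rcases mem_seen_succ.1 h with h | h | ⟨p, hp, h⟩
    · simp only [Prod.mk.injEq] at h
      omega
    · obtain ⟨y, h1, h2, h3⟩ := ih h (by omega)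
      exact ⟨y, mem_seen_succ.2 (Or.inr (Or.inl h1)), h2, h3⟩
    · obtain ⟨y, h1, h2, h3⟩ := ih h (by omega)
      refine ⟨y, mem_seen_succ.2 (Or.inr (Or.inr ⟨p, hp, h1⟩)), h2, Or.inr ?_⟩
      rcases h3 with rfl | h3
      · exact (active_of_delivered hp.1 hp.2).mono (by omega)
      · exact h3

/-- The node `⟨j, l⟩` is hidden from `⟨i, m⟩`. -/
def HiddenFrom (α : Adversary n d t) (m : ℕ) (i j : Fin n) (l : ℕ) : Prop :=
  (j, l) ∉ α.seen m i ∧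
    ∀ p s, (p, s + 1) ∈ α.seen m i → s + 1 ≤ l → j = p ∨ α.delivered s j p

/-- `⟨i, m⟩` has seen an initial value smaller than `k`. -/
def SeesLow (k : ℕ) (α : Adversary n d t) (m : ℕ) (i : Fin n) : Prop :=
  ∃ j, (j, 0) ∈ α.seen m i ∧ (α.input j : ℕ) < k

/-- At every time `l ≤ m` there are `k` nodes that are hidden from `⟨i, m⟩`. -/
def HasHidden (k : ℕ) (α : Adversary n d t) (m : ℕ) (i : Fin n) : Prop :=
  ∀ l, l ≤ m → ∃ A : Finset (Fin n), A.card = k ∧ ∀ j ∈ A, α.HiddenFrom m i j l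

/-- The condition under which `optMin` decides. -/
def Ready (k : ℕ) (α : Adversary n d t) (m : ℕ) (i : Fin n) : Prop :=
  α.SeesLow k m i ∨ ¬ α.HasHidden k m i

theorem HiddenFrom.not_delivered {α : Adversary n d t} {m l s : ℕ} {i j : Fin n}
    (h : α.HiddenFrom m i j l) (hls : l ≤ s) (hsm : s < m) : ¬ α.delivered s j i := by
  intro hd
  have hji : j ≠ i := by
    rintro rfl
    exact h.1 (α.self_mem_seen j (by omega))
  have h1 := mem_seen_of_delivered (α.self_mem_seen i (show s + 1 ≤ m from hsm)) hji hd
  exact h.1 (seen_subset h1 (α.self_mem_seen j hls))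

theorem HiddenFrom.ne {α : Adversary n d t} {m l : ℕ} {i j : Fin n}
    (h : α.HiddenFrom m i j l) (hlm : l ≤ m) : j ≠ i := by
  rintro rfl
  exact h.1 (α.self_mem_seen j hlm)

/-- If `j` is hidden at time `l`, then `i` does not hear from it in round `l + 1`, and this proves
that `j` has crashed at all times after `l`. Hence sets of hidden processes at different times are
disjoint, which yields both termination and the disjointness of chains. -/
theorem HiddenFrom.time_eq {α : Adversary n d t} {m l l' : ℕ} {i j : Fin n}
    (h : α.HiddenFrom m i j l) (h' : α.HiddenFrom m i j l') (hl : l ≤ m) (hl' : l' ≤ m) :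
    l = l' := by
  by_contra hne
  wlog hlt : l < l' generalizing l l'
  · exact this h' h hl' hl (Ne.symm hne) (by omega)
  rcases h'.2 i l (α.self_mem_seen i (by omega)) hlt with rfl | hd
  · exact h.ne hl rfl
  · exact h.not_delivered le_rfl (by omega) hd

end Adversary

/-! ### Views in runs of `optMin`, translated into seen nodes. -/

/-- The view of `⟨i, m⟩` in the run of `optMin`. -/
noncomputable def view (k : ℕ) (α : Adversary n d t) (m : ℕ) (i : Fin n) : View n d :=
  (optMin n d k).state α m i

section
variable {k : ℕ} {α : Adversary n d t}

open Classical in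
theorem view_succ (m : ℕ) (i : Fin n) : view k α (m + 1) i =
    View.extend i (view k α m i)
      (fun j => if j ≠ i ∧ α.delivered m j i then some (view k α m j) else none) := rfl

theorem view_root (m : ℕ) (i : Fin n) : (view k α m i).root = (i, m) := by
  induction m with
  | zero => rfl
  | succ m ih => rw [view_succ]; simp [View.extend, ih]

theorem view_nodes (m : ℕ) (i : Fin n) : (view k α m i).nodes = α.seen m i := by
  induction m generalizing i with
  | zero => rfl
  | succ m ih =>
    rw [view_succ]
    ext x
    simp only [View.extend, view_root, ih, Adversary.seen, Set.mem_union, Set.mem_ofPred_eq,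
      Option.ite_none_right_eq_some, Option.some.injEq]
    refine or_congr Iff.rfl (exists_congr fun j => ?_)
    constructor
    · rintro ⟨h, ⟨h1, rfl⟩, h2⟩
      exact ⟨h1, by rwa [ih] at h2⟩
    · rintro ⟨h1, h2⟩
      exact ⟨_, ⟨h1, rfl⟩, by rwa [ih]⟩

theorem mem_view_edges {m : ℕ} {i j p : Fin n} {s s' : ℕ} :
    ((j, s), (p, s')) ∈ (view k α m i).edges ↔
      s' = s + 1 ∧ (p, s + 1) ∈ α.seen m i ∧ (j = p ∨ α.delivered s j p) := by
  induction m generalizing i with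
  | zero =>
    simp only [view, Protocol.state, optMin, fullInformation, View.initial, Adversary.seen]
    simp
  | succ m ih =>
    rw [view_succ]
    simp only [View.extend, view_root, Set.mem_union, Set.mem_ofPred_eq,
      Option.ite_none_right_eq_some, Option.some.injEq, Adversary.mem_seen_succ]
    constructor
    · rintro ((⟨j', h1, h2⟩ | h) | ⟨q, g, ⟨h1, rfl⟩, h2⟩)
      · simp only [Prod.mk.injEq] at h2
        obtain ⟨⟨rfl, rfl⟩, rfl, rfl⟩ := h2
        refine ⟨rfl, Or.inl rfl, ?_⟩
        rcases h1 with h1 | h1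
        · exact Or.inl h1
        · right
          by_contra hn
          simp [hn] at h1
      · obtain ⟨h1, h2, h3⟩ := ih.1 h
        exact ⟨h1, Or.inr (Or.inl h2), h3⟩
      · obtain ⟨h3, h4, h5⟩ := ih.1 h2
        exact ⟨h3, Or.inr (Or.inr ⟨q, h1, h4⟩), h5⟩
    · rintro ⟨rfl, h | h | ⟨q, h1, h2⟩, h3⟩
      · simp only [Prod.mk.injEq] at h
        obtain ⟨rfl, hs⟩ := h
        obtain rfl : s = m := by omega
        refine Or.inl (Or.inl ⟨j, ?_, rfl⟩)
        by_cases hj : j = p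
        · exact Or.inl hj
        · right
          simp [hj, h3.resolve_left hj]
      · exact Or.inl (Or.inr (ih.2 ⟨rfl, h, h3⟩))
      · exact Or.inr ⟨q, _, ⟨h1, rfl⟩, ih.2 ⟨rfl, h2, h3⟩⟩

theorem mem_view_labels {m : ℕ} {i j : Fin n} {v : Fin (d + 1)} :
    (j, v) ∈ (view k α m i).labels ↔ (j, 0) ∈ α.seen m i ∧ α.input j = v := by
  induction m generalizing i with
  | zero =>
    simp only [view, Protocol.state, optMin, fullInformation, View.initial, Adversary.seen,
      Set.mem_singleton_iff, Prod.mk.injEq]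
    constructor
    · rintro ⟨rfl, rfl⟩; simp
    · rintro ⟨⟨rfl, -⟩, rfl⟩; simp
  | succ m ih =>
    rw [view_succ]
    simp only [View.extend, Set.mem_union, Set.mem_ofPred_eq, ih,
      Option.ite_none_right_eq_some, Option.some.injEq, Adversary.mem_seen_succ]
    constructor
    · rintro (⟨h1, h2⟩ | ⟨q, g, ⟨h1, rfl⟩, h2⟩)
      · exact ⟨Or.inr (Or.inl h1), h2⟩
      · obtain ⟨h3, h4⟩ := ih.1 h2
        exact ⟨Or.inr (Or.inr ⟨q, h1, h3⟩), h4⟩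
    · rintro ⟨h | h | ⟨q, h1, h2⟩, h3⟩
      · simp at h
      · exact Or.inl ⟨h, h3⟩
      · exact Or.inr ⟨q, _, ⟨h1, rfl⟩, ih.2 ⟨h2, h3⟩⟩

theorem mem_view_vals {m : ℕ} {i : Fin n} {v : Fin (d + 1)} :
    v ∈ (view k α m i).vals ↔ ∃ j, (j, 0) ∈ α.seen m i ∧ α.input j = v := by
  simp only [View.vals, Set.mem_ofPred_eq, mem_view_labels]

theorem view_minVal_mem (m : ℕ) (i : Fin n) :
    ∃ j, (j, 0) ∈ α.seen m i ∧ α.input j = (view k α m i).minVal := by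
  rw [← mem_view_vals]
  exact csInf_mem ⟨_, mem_view_vals.2 ⟨i, α.self_mem_seen i (Nat.zero_le m), rfl⟩⟩

theorem view_minVal_le {m : ℕ} {i j : Fin n} (h : (j, 0) ∈ α.seen m i) :
    (view k α m i).minVal ≤ α.input j :=
  csInf_le (Set.toFinite _).bddBelow (mem_view_vals.2 ⟨j, h, rfl⟩)

theorem view_low {m : ℕ} {i : Fin n} : (view k α m i).Low k ↔ α.SeesLow k m i := by
  constructor
  · intro h
    obtain ⟨j, h1, h2⟩ := view_minVal_mem (k := k) (α := α) m i
    exact ⟨j, h1, by rw [h2]; exact h⟩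
  · rintro ⟨j, h1, h2⟩
    exact lt_of_le_of_lt (view_minVal_le (k := k) h1) h2

theorem view_hidden {m l : ℕ} {i j : Fin n} :
    (view k α m i).Hidden j l ↔ α.HiddenFrom m i j l := by
  simp only [View.Hidden, View.Seen, View.GuaranteedCrashed, Adversary.HiddenFrom, view_nodes,
    mem_view_edges]
  refine and_congr Iff.rfl ?_
  push Not
  constructor
  · intro h p s h1 h2
    exact (h p s h1 h2).2.2
  · intro h p s h1 h2
    exact ⟨trivial, h1, h p s h1 h2⟩

theorem view_hiddenCapacity {m : ℕ} {i : Fin n} :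
    (view k α m i).hiddenCapacity < k ↔ ¬ α.HasHidden k m i := by
  rw [← not_le, not_iff_not]
  simp only [View.hiddenCapacity, view_root, view_hidden]
  -- The bound matters: `sSup` of an unbounded set of naturals is `0`.
  have hb : BddAbove {c : ℕ | ∀ l ≤ m, ∃ A : Finset (Fin n), A.card = c ∧
      ∀ j ∈ A, α.HiddenFrom m i j l} := by
    refine ⟨n, fun c hc => ?_⟩
    obtain ⟨A, rfl, -⟩ := hc m le_rfl
    simpa using A.card_le_univ
  constructor
  · intro h l hl
    obtain ⟨A, h1, h2⟩ := Nat.sSup_mem ⟨0, fun l _ => ⟨∅, rfl, by simp⟩⟩ hb l hl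
    rw [← h1] at h
    obtain ⟨B, hB, hc⟩ := Finset.exists_subset_card_eq h
    exact ⟨B, hc, fun j hj => h2 j (hB hj)⟩
  · intro h
    exact le_csSup hb h

open Classical in
theorem optMin_decision (m : ℕ) (i : Fin n) :
    (optMin n d k).decision i ((optMin n d k).state α m i) =
      if α.Ready k m i then some (view k α m i).minVal else none := by
  change (if (view k α m i).Low k ∨ (view k α m i).hiddenCapacity < k then
    some (view k α m i).minVal else none) = _
  simp only [view_low, view_hiddenCapacity, Adversary.Ready]
  congr

theorem optMin_decides {m : ℕ} {i : Fin n} {v : Fin (d + 1)} :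
    (optMin n d k).Decides α i m v ↔ α.Active i m ∧
      (α.Ready k m i ∧ (view k α m i).minVal = v) ∧ ∀ m', m' < m → ¬ α.Ready k m' i := by
  simp only [Protocol.Decides, optMin_decision, Option.ite_none_right_eq_some, Option.some.injEq,
    ite_eq_right_iff, reduceCtorEq, imp_false]

end

/-! ### Indistinguishable runs. -/

/-- The state at a node depends only on what the node has seen. -/
theorem state_congr_of_seen (P : Protocol n d) {α β : Adversary n d t} {m : ℕ} {i : Fin n}
    (hin : ∀ p, (p, 0) ∈ α.seen m i → α.input p = β.input p)
    (hdel : ∀ s j p, (p, s + 1) ∈ α.seen m i → j ≠ p → (α.delivered s j p ↔ β.delivered s j p))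
    {s : ℕ} {p : Fin n} (h : (p, s) ∈ α.seen m i) : P.state α s p = P.state β s p := by
  induction s generalizing p with
  | zero => simp only [Protocol.state, hin p h]
  | succ s ih =>
    simp only [Protocol.state]
    rw [ih (Adversary.mem_seen_of_succ_mem h)]
    congr 1
    funext j
    by_cases hj : j ≠ p ∧ α.delivered s j p
    · rw [if_pos hj, if_pos ⟨hj.1, (hdel s j p h hj.1).1 hj.2⟩,
        ih (Adversary.mem_seen_of_delivered h hj.1 hj.2)]
    · rw [if_neg hj, if_neg fun h' => hj ⟨h'.1, (hdel s j p h h'.1).2 h'.2⟩]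

theorem ready_congr {k : ℕ} {α β : Adversary n d t} {m : ℕ} {i : Fin n}
    (h : (optMin n d k).state α m i = (optMin n d k).state β m i) :
    α.Ready k m i ↔ β.Ready k m i := by
  classical
  have h1 := optMin_decision (k := k) (α := α) m i
  rw [h, optMin_decision] at h1
  by_cases ha : α.Ready k m i <;> by_cases hb : β.Ready k m i <;> simp_all

theorem decides_of_exists_isSome {P : Protocol n d} {α : Adversary n d t} {i : Fin n} {m : ℕ}
    (ha : α.Active i m) (h : ∃ m' ≤ m, (P.decision i (P.state α m' i)).isSome) :
    ∃ m' ≤ m, ∃ v, P.Decides α i m' v := by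
  classical
  obtain ⟨m', hm, h⟩ := h
  have he : ∃ s, (P.decision i (P.state α s i)).isSome := ⟨m', h⟩
  have hle : Nat.find he ≤ m := (Nat.find_min' he h).trans hm
  obtain ⟨v, hv⟩ := Option.isSome_iff_exists.1 (Nat.find_spec he)
  exact ⟨_, hle, v, ha.mono hle, hv, fun s hs => by simpa using Nat.find_min he hs⟩

end SetConsensus

/-! ### `optMin` solves nonuniform `k`-set consensus. -/

namespace SetConsensus

variable {n d t k : ℕ}

/-- Otherwise each of the `n + 1` times `0, …, n` has a hidden process, and these are distinct by
`HiddenFrom.time_eq`. -/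
theorem Adversary.exists_ready (hk : 1 ≤ k) (α : Adversary n d t) (i : Fin n) :
    α.Ready k n i := by
  refine Or.inr fun h => ?_
  have h1 : ∀ l : Fin (n + 1), ∃ j, α.HiddenFrom n i j l := by
    intro l
    obtain ⟨A, hA, h2⟩ := h l (by omega)
    obtain ⟨j, hj⟩ := Finset.card_pos.1 (by omega : 0 < A.card)
    exact ⟨j, h2 j hj⟩
  choose f hf using h1
  have hinj : Function.Injective f := by
    intro l l' he
    have h2 := hf l'
    rw [← he] at h2
    exact Fin.ext ((hf l).time_eq h2 (by omega) (by omega))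
  have := Fintype.card_le_of_injective f hinj
  simp at this

/-- Let `w` be the largest value decided by correct processes. If `w ≥ k`, its decider `⟨i, m⟩` has
fewer than `k` hidden nodes at some time `l`. Every smaller decided value is the minimum seen by a
process hidden at time `l`, and different values need different processes, so fewer than `k` values
lie below `w`. -/
theorem optMin_agreement (α : Adversary n d t) :
    {v | ∃ i ∈ α.correct, ∃ m, (optMin n d k).Decides α i m v}.ncard ≤ k := by
  set V := {v | ∃ i ∈ α.correct, ∃ m, (optMin n d k).Decides α i m v} with hV
  by_cases hlow : ∀ v ∈ V, (v : ℕ) < k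
  · have := Set.ncard_le_ncard_of_injOn (s := V) (t := (Finset.range k : Set ℕ)) Fin.val
      (fun v hv => by simpa using hlow v hv) (Fin.val_injective.injOn)
    simpa [Set.ncard_coe_finset] using this
  push Not at hlow
  obtain ⟨v₀, hv₀, hk₀⟩ := hlow
  obtain ⟨w, hw, hmax⟩ := Set.exists_max_image V id (Set.toFinite V) ⟨v₀, hv₀⟩
  have hkw : k ≤ (w : ℕ) := hk₀.trans (hmax v₀ hv₀)
  obtain ⟨i, hi, m, hd⟩ := hw
  obtain ⟨-, ⟨hr, hmin⟩, -⟩ := optMin_decides.1 hd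
  have hnl : ¬ α.SeesLow k m i := by
    rw [← view_low, View.Low, hmin]
    omega
  have hnh := hr.resolve_left hnl
  simp only [Adversary.HasHidden, not_forall] at hnh
  obtain ⟨l, hl, hA⟩ := hnh
  have hy : ∀ v : V, (v : Fin (d + 1)) ≠ w →
      ∃ y, α.HiddenFrom m i y l ∧ (view k α l y).minVal = v := by
    rintro ⟨v, j, hj, mj, hdj⟩ hne
    have hlt : v < w := lt_of_le_of_ne (hmax v ⟨j, hj, mj, hdj⟩) hne
    obtain ⟨-, ⟨-, hminj⟩, -⟩ := optMin_decides.1 hdj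
    obtain ⟨x, hx, hxv⟩ := view_minVal_mem (k := k) (α := α) mj j
    rw [hminj] at hxv
    have hnot : (x, 0) ∉ α.seen m i := by
      intro h
      have := view_minVal_le (k := k) h
      rw [hmin, hxv] at this
      exact absurd hlt this.not_gt
    -- Had the correct process `j` decided earlier, its next message would have brought `⟨x, 0⟩` to
    -- `i` by time `m`.
    have hmj : m ≤ mj := by
      by_contra hlt'
      refine hnot (Adversary.seen_subset ?_ hx)
      by_cases hji : j = i
      · subst hji
        exact α.self_mem_seen j (by omega)
      · exact Adversary.mem_seen_of_delivered (α.self_mem_seen i (by omega)) hji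
          (hj mj i (Ne.symm hji))
    obtain ⟨y, h1, h2, h3⟩ := Adversary.exists_mem_seen_between hx (Nat.zero_le l) (hl.trans hmj)
    have h3 : α.Active y l := by
      rcases h3 with rfl | h3
      · exact Adversary.active_of_mem_correct hj l
      · exact h3
    -- Seeing `⟨y, l⟩` would mean seeing `⟨x, 0⟩`; and nobody can prove that `y` crashed, as it is
    -- active at time `l`.
    refine ⟨y, ⟨fun h => hnot (Adversary.seen_subset h h2), fun p s _ hs => ?_⟩, le_antisymm ?_ ?_⟩
    · by_cases hyp : y = p
      · exact Or.inl hyp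
      · exact Or.inr (h3 s hs p (Ne.symm hyp))
    · change _ ≤ v
      rw [← hxv]
      exact view_minVal_le h2
    · obtain ⟨x', hx', he⟩ := view_minVal_mem (k := k) (α := α) l y
      rw [← he]
      change v ≤ _
      rw [← hminj]
      exact view_minVal_le (Adversary.seen_subset h1 hx')
  choose f hf hfv using hy
  by_contra hcard
  apply hA
  classical
  have hfin : Fintype {v : V // (v : Fin (d + 1)) ≠ w} := Fintype.ofFinite _
  let g : {v : V // (v : Fin (d + 1)) ≠ w} → Fin n := fun v => f v.1 v.2
  have hg : Function.Injective g := by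
    intro v v' he
    have h1 := hfv v.1 v.2
    have h2 := hfv v'.1 v'.2
    change f v.1 v.2 = f v'.1 v'.2 at he
    rw [← he, h1] at h2
    exact Subtype.ext (Subtype.ext h2)
  have hc : k ≤ (Finset.univ.image g).card := by
    rw [Finset.card_image_of_injective _ hg, Finset.card_univ]
    have h1 : (V \ {w}).ncard + 1 = V.ncard := Set.ncard_sdiff_singleton_add_one
      (show w ∈ V from ⟨i, hi, m, hd⟩)
    have h2 : (V \ {w}).ncard ≤ Fintype.card {v : V // (v : Fin (d + 1)) ≠ w} := by
      rw [← Nat.card_coe_set_eq, ← Nat.card_eq_fintype_card]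
      refine Nat.card_le_card_of_injective
        (fun v : (V \ {w} : Set _) => (⟨⟨v.1, v.2.1⟩, v.2.2⟩ : {v : V // (v : Fin (d + 1)) ≠ w})) ?_
      intro v v' he
      simpa [Subtype.ext_iff] using he
    omega
  obtain ⟨B, hB, hBc⟩ := Finset.exists_subset_card_eq hc
  refine ⟨B, hBc, fun j hj => ?_⟩
  obtain ⟨v, -, rfl⟩ := Finset.mem_image.1 (hB hj)
  exact hf v.1 v.2

theorem optMin_solves (hk : 1 ≤ k) : (optMin n d k).Solves k t where
  agreement := optMin_agreement
  decision := by
    classical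
    intro α i hi
    obtain ⟨m, -, v, h⟩ := decides_of_exists_isSome (P := optMin n d k)
      (Adversary.active_of_mem_correct hi n)
      ⟨n, le_rfl, by rw [optMin_decision, if_pos (α.exists_ready hk i)]; rfl⟩
    exact ⟨m, v, h⟩
  validity := by
    intro α i m v h
    obtain ⟨-, ⟨-, hmin⟩, -⟩ := optMin_decides.1 h
    obtain ⟨j, -, hj⟩ := view_minVal_mem (k := k) (α := α) m i
    exact ⟨j, hj.trans hmin⟩

end SetConsensus

/-! ### Decisions forced by last-decider domination. -/

namespace SetConsensus

variable {n d t k : ℕ}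

namespace Adversary

/-- The failure-free adversary. -/
def failureFree (n d t : ℕ) (inp : Fin n → Fin (d + 1)) : Adversary n d t where
  input := inp
  delivered _ _ _ := True
  crash := by simp
  faulty_le := by simp

theorem active_failureFree (inp : Fin n → Fin (d + 1)) (i : Fin n) (m : ℕ) :
    (failureFree n d t inp).Active i m := fun _ _ _ _ => trivial

theorem mem_correct_failureFree (inp : Fin n → Fin (d + 1)) (i : Fin n) :
    i ∈ (failureFree n d t inp).correct := fun _ _ _ => trivial

/-- The adversary that agrees with `α` up to time `m`, in which round `m + 1` delivers a message of
`j` if and only if `α` delivers the message of `j` to `i`, and in which no more crashes occur. -/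
def flatten (α : Adversary n d t) (m : ℕ) (i : Fin n) : Adversary n d t where
  input := α.input
  delivered r j q :=
    (r < m ∧ α.delivered r j q) ∨ (m ≤ r ∧ α.Active j m ∧ (j = i ∨ α.delivered m j i))
  crash := by
    rintro j r ⟨q, hq, h⟩ r' hr q' hq' h'
    rcases lt_or_ge r m with hrm | hrm
    · have hn : ¬ α.delivered r j q := fun hd => h (Or.inl ⟨hrm, hd⟩)
      rcases h' with ⟨-, h'⟩ | ⟨-, h', -⟩
      · exact α.crash j r ⟨q, hq, hn⟩ r' hr q' hq' h'
      · exact hn (h' r hrm q hq)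
    · rcases h' with ⟨h', -⟩ | ⟨-, h'⟩
      · omega
      · exact h (Or.inr ⟨hrm, h'⟩)
  faulty_le := by
    refine (Set.ncard_le_ncard ?_ (Set.toFinite _)).trans α.faulty_le
    rintro j ⟨r, q, hq, h⟩
    by_contra hc
    simp only [Set.mem_ofPred_eq, not_exists, not_and, not_not] at hc
    refine h ?_
    rcases lt_or_ge r m with hrm | hrm
    · exact Or.inl ⟨hrm, hc r q hq⟩
    · refine Or.inr ⟨hrm, fun s _ p hp => hc s p hp, ?_⟩
      by_cases hji : j = i
      · exact Or.inl hji
      · exact Or.inr (hc m i (Ne.symm hji))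

theorem flatten_delivered_of_lt {α : Adversary n d t} {m r : ℕ} {i j q : Fin n} (h : r < m) :
    (α.flatten m i).delivered r j q ↔ α.delivered r j q := by
  simp [flatten, h, h.not_ge]

theorem flatten_delivered_of_le {α : Adversary n d t} {m r : ℕ} {i j q : Fin n} (h : m ≤ r) :
    (α.flatten m i).delivered r j q ↔ α.Active j m ∧ (j = i ∨ α.delivered m j i) := by
  simp [flatten, h, h.not_gt]

theorem flatten_delivered_self {α : Adversary n d t} {m : ℕ} {i j : Fin n} (h : j ≠ i) :
    (α.flatten m i).delivered m j i ↔ α.delivered m j i := by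
  rw [flatten_delivered_of_le le_rfl]
  simp only [h, false_or, and_iff_right_iff_imp]
  exact active_of_delivered h

theorem flatten_mem_correct {α : Adversary n d t} {m : ℕ} {i : Fin n} (h : α.Active i (m + 1)) :
    i ∈ (α.flatten m i).correct := by
  intro r q hq
  rcases lt_or_ge r m with hrm | hrm
  · exact (flatten_delivered_of_lt hrm).2 (h r (by omega) q hq)
  · exact (flatten_delivered_of_le hrm).2 ⟨h.mono m.le_succ, Or.inl rfl⟩

theorem flatten_state (P : Protocol n d) (α : Adversary n d t) (m : ℕ) (i : Fin n) {s : ℕ}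
    (hs : s ≤ m + 1) : P.state α s i = P.state (α.flatten m i) s i := by
  refine state_congr_of_seen P (α := α) (β := α.flatten m i) (m := m + 1) (i := i) (fun _ _ => rfl) (fun r j p hp hj => ?_)
    (α.self_mem_seen i hs)
  rcases (le_of_mem_seen hp).eq_or_lt with h | h
  · obtain rfl : r = m := by omega
    obtain rfl := eq_of_mem_seen_self hp
    exact (flatten_delivered_self hj).symm
  · exact (flatten_delivered_of_lt (by omega)).symm

/-- After a round in which every sender reaches either everybody or nobody, all active processes
have seen the same nodes up to the previous time. -/
theorem mem_flatten_seen {α : Adversary n d t} {m : ℕ} {i q : Fin n}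
    (hq : α.Active q m ∧ (q = i ∨ α.delivered m q i)) {x : Fin n × ℕ} :
    x ∈ (α.flatten m i).seen (m + 1) q ↔ x = (q, m + 1) ∨
      ∃ j, (α.Active j m ∧ (j = i ∨ α.delivered m j i)) ∧ x ∈ (α.flatten m i).seen m j := by
  rw [mem_seen_succ]
  refine or_congr Iff.rfl ?_
  simp only [flatten_delivered_of_le le_rfl]
  constructor
  · rintro (h | ⟨j, ⟨-, h1⟩, h2⟩)
    · exact ⟨q, hq, h⟩
    · exact ⟨j, h1, h2⟩
  · rintro ⟨j, h1, h2⟩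
    by_cases hj : j = q
    · exact Or.inl (hj ▸ h2)
    · exact Or.inr ⟨j, ⟨hj, h1⟩, h2⟩

/-- After the flattened round `i` and `q` have seen the same nodes up to time `m` and heard from the
same processes. Exchanging `i` and `q` therefore turns nodes hidden from `q` into nodes hidden from
`i`. -/
theorem flatten_ready {α : Adversary n d t} {m : ℕ} {i q : Fin n} (hi : α.Active i (m + 1))
    (hr : α.Ready k (m + 1) i) (hq : (α.flatten m i).Active q (m + 1)) :
    (α.flatten m i).Ready k (m + 1) q := by
  rw [ready_congr (flatten_state (optMin n d k) α m i le_rfl)] at hr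
  by_cases hqi : q = i
  · rwa [hqi]
  set β := α.flatten m i with hβ
  have hDq : α.Active q m ∧ (q = i ∨ α.delivered m q i) :=
    (flatten_delivered_of_le le_rfl).1 (hq m m.lt_succ_self i (Ne.symm hqi))
  have hDi : α.Active i m ∧ (i = i ∨ α.delivered m i i) := ⟨hi.mono m.le_succ, Or.inl rfl⟩
  have hiq : ∀ x, x ∈ β.seen (m + 1) i → x.2 ≤ m → x ∈ β.seen (m + 1) q := by
    intro x hx hm
    rcases (mem_flatten_seen hDi).1 hx with rfl | h
    · simp at hm
    · exact (mem_flatten_seen hDq).2 (Or.inr h)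
  rcases hr with ⟨j, h1, h2⟩ | hr
  · exact Or.inl ⟨j, hiq _ h1 (Nat.zero_le _), h2⟩
  refine Or.inr fun hh => hr fun l hl => ?_
  obtain ⟨A, hA, hid⟩ := hh l hl
  refine ⟨A.map (Equiv.swap i q).toEmbedding, by simpa using hA, ?_⟩
  intro j' hj'
  obtain ⟨j, hj, rfl⟩ := Finset.mem_map.1 hj'
  have hj := hid j hj
  change β.HiddenFrom (m + 1) i (Equiv.swap i q j) l
  have hjq : j ≠ q := hj.ne hl
  by_cases hji : j = i
  · subst hji
    rw [Equiv.swap_apply_left]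
    -- The nodes of `i` up to time `m` are seen by `q`, so only its current node can be hidden.
    have hlm : l = m + 1 := by
      by_contra hlm
      exact hj.1 ((mem_flatten_seen hDq).2 (Or.inr ⟨j, hDi, β.self_mem_seen j (by omega)⟩))
    subst hlm
    refine ⟨fun h => hqi (eq_of_mem_seen_self h), fun p s _ hs => ?_⟩
    by_cases hqp : q = p
    · exact Or.inl hqp
    · exact Or.inr (hq s (by omega) p (Ne.symm hqp))
  · rw [Equiv.swap_apply_of_ne_of_ne hji hjq]
    constructor
    · intro h
      rcases hl.eq_or_lt with rfl | hl
      · exact hji (eq_of_mem_seen_self h)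
      · exact hj.1 (hiq _ h (by simp only; omega))
    · intro p s hp hs
      by_cases hsm : s = m
      · subst hsm
        obtain rfl := eq_of_mem_seen_self hp
        right
        have h1 := hj.2 q s (β.self_mem_seen q le_rfl) hs
        rw [flatten_delivered_of_le le_rfl] at h1 ⊢
        exact h1.resolve_left hjq
      · have := le_of_mem_seen hp
        exact hj.2 p s (hiq _ hp (by simp only; omega)) hs

/-- This handles time `0`, where there is no last round to flatten; giving all processes the same
input makes their views interchangeable. -/
theorem failureFree_ready {α : Adversary n d t} {i : Fin n} (hr : α.Ready k 0 i) (q : Fin n) :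
    (failureFree n d t fun _ => α.input i).Ready k 0 q := by
  rcases hr with ⟨j, h1, h2⟩ | hr
  · obtain rfl := eq_of_mem_seen_self h1
    exact Or.inl ⟨q, self_mem_seen _ q le_rfl, h2⟩
  refine Or.inr fun hh => hr fun l hl => ?_
  obtain ⟨A, hA, hid⟩ := hh l hl
  obtain rfl : l = 0 := by omega
  refine ⟨A.map (Equiv.swap i q).toEmbedding, by simpa using hA, fun j' hj' => ⟨fun h => ?_, ?_⟩⟩
  · obtain ⟨j, hj, rfl⟩ := Finset.mem_map.1 hj'
    have h := eq_of_mem_seen_self h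
    refine (hid j hj).ne hl ?_
    rw [← Equiv.swap_apply_right i q] at h
    simpa using congrArg (Equiv.swap i q) h
  · intro p s _ hs
    omega

end Adversary

section
variable {S : Adversary n d t → Set (Fin n)} {Q : Protocol n d}

/-- All decisions of `optMin` are taken by time `m`. A last one exists because the correct process
`i` decides, and domination then bounds the decision time of `i` under `Q`. Assuming only `α.correct
⊆ S α` treats both ways of counting decisions at once. -/
theorem exists_decision_of_forall_ready (hS : ∀ α, α.correct ⊆ S α) (hk : 1 ≤ k)
    (hQ : Q.Solves k t) (hdom : Protocol.LastDeciderDominates S Q (optMin n d k))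
    (α : Adversary n d t) {i : Fin n} {m : ℕ} (hi : i ∈ α.correct)
    (hr : ∀ q, α.Active q m → α.Ready k m q) :
    ∃ m' ≤ m, (Q.decision i (Q.state α m' i)).isSome := by
  set T := (optMin n d k).decisionTimes α (S α) with hT
  have hle : ∀ m' ∈ T, m' ≤ m := by
    rintro m' ⟨q, -, v, h⟩
    obtain ⟨h1, -, h2⟩ := optMin_decides.1 h
    by_contra hlt
    exact h2 m (by omega) (hr q (h1.mono (by omega)))
  obtain ⟨mi, v, hv⟩ := (optMin_solves hk).decision α i hi
  have hmi : mi ∈ T := ⟨i, hS α hi, v, hv⟩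
  have hfin : T.Finite := (Set.finite_Iic m).subset hle
  obtain ⟨M, hM, hmax⟩ := Set.exists_max_image T id hfin ⟨mi, hmi⟩
  obtain ⟨m', v', hd⟩ := hQ.decision α i hi
  refine ⟨m', (hdom α M ⟨hM, fun x hx => hmax x hx⟩ m' ⟨i, hS α hi, v', hd⟩).trans (hle M hM), ?_⟩
  rw [hd.2.1]
  rfl

/-- Last-decider domination of `optMin` forces a decision at every active node at which `optMin`
decides. -/
theorem exists_decision_of_ready (hS : ∀ α, α.correct ⊆ S α) (hk : 1 ≤ k)
    (hQ : Q.Solves k t) (hdom : Protocol.LastDeciderDominates S Q (optMin n d k))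
    {α : Adversary n d t} {i : Fin n} {m : ℕ} (ha : α.Active i m) (hr : α.Ready k m i) :
    ∃ m' ≤ m, (Q.decision i (Q.state α m' i)).isSome := by
  cases m with
  | zero =>
    obtain ⟨m', hm', h⟩ := exists_decision_of_forall_ready hS hk hQ hdom
      (Adversary.failureFree n d t fun _ => α.input i) (Adversary.mem_correct_failureFree _ i)
      (fun q _ => Adversary.failureFree_ready hr q)
    obtain rfl : m' = 0 := by omega
    exact ⟨0, le_rfl, h⟩
  | succ m =>
    obtain ⟨m', hm', h⟩ := exists_decision_of_forall_ready hS hk hQ hdom (α.flatten m i)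
      (Adversary.flatten_mem_correct ha) (fun q hq => Adversary.flatten_ready ha hr hq)
    exact ⟨m', hm', by rwa [Adversary.flatten_state Q α m i hm']⟩

end

end SetConsensus

/-! ### A rainbow lemma from Hall's theorem. -/

namespace SetConsensus

/-- A rainbow lemma. Processes `p : P` with views `Z : Finset K` take colours in `Option K` according
to `R`; a process only takes colours in its view, or the additional colour `none`, and it takes some
colour when its view is nonempty. If `none` is taken at all and there are more processes than colours
in `K`, then for some `X` the colours outside `X` are all taken, by distinct processes with views that
contain `X`. -/
theorem exists_rainbow {K P : Type*} [Fintype K] [DecidableEq K] [Fintype P]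
    (R : P → Finset K → Option K → Prop)
    (hcard : Fintype.card K + 1 ≤ Fintype.card P)
    (hmem : ∀ p Z c, R p Z (some c) → c ∈ Z)
    (htot : ∀ p Z, Z.Nonempty → ∃ c, R p Z c)
    (hnone : ∃ p Z, R p Z none) :
    ∃ (X : Finset K) (q : Option K → P) (Z : Option K → Finset K),
      (∀ c, (∀ x ∈ X, c ≠ some x) → X ⊆ Z c ∧ R (q c) (Z c) c) ∧
      ∀ c c', (∀ x ∈ X, c ≠ some x) → (∀ x ∈ X, c' ≠ some x) → q c = q c' → c = c' := by
  classical
  -- A maximal good `X` is the one sought: `A` holds enough processes that avoid the colours of `X`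
  -- on views containing `X`, and Hall's condition for the remaining colours is shown by
  -- contradiction. If a set `s` of colours has too few takers `B`, then `A \ B` avoids `X` and `s`.
  let good : Finset K → Prop := fun X => ∃ A : Finset P,
    Fintype.card K + 1 ≤ A.card + X.card ∧
    (∀ p ∈ A, ∀ Z, X ⊆ Z → ∀ x ∈ X, ¬ R p Z (some x)) ∧
    ∃ p ∈ A, ∃ Z, X ⊆ Z ∧ R p Z none
  have h0 : good ∅ := by
    obtain ⟨p, Z, h⟩ := hnone
    exact ⟨Finset.univ, by simpa using hcard, by simp, p, by simp, Z, by simp, h⟩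
  obtain ⟨X, hX, hmax⟩ := Set.exists_max_image {X | good X} Finset.card (Set.toFinite _) ⟨∅, h0⟩
  obtain ⟨A, hA, havoid, p₀, hp₀, Z₀, hZ₀, hR₀⟩ := hX
  let N : Option K → Finset P := fun c => A.filter fun p => ∃ Z, X ⊆ Z ∧ R p Z c
  let I := {c : Option K // ∀ x ∈ X, c ≠ some x}
  have hall : ∀ s : Finset I, s.card ≤ (s.biUnion fun c => N c.1).card := by
    intro s
    by_contra hlt
    push Not at hlt
    set B := s.biUnion fun c => N c.1 with hB
    have hBA : B ⊆ A := Finset.biUnion_subset.2 fun c _ => Finset.filter_subset _ _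
    have hcd : (A \ B).card = A.card - B.card := Finset.card_sdiff_of_subset hBA
    have hle := Finset.card_le_card hBA
    have hav : ∀ p ∈ A \ B, ∀ Z, X ⊆ Z → ∀ c ∈ s, ¬ R p Z c.1 := by
      intro p hp Z hZ c hc h
      rw [Finset.mem_sdiff] at hp
      exact hp.2 (Finset.mem_biUnion.2 ⟨c, hc, Finset.mem_filter.2 ⟨hp.1, Z, hZ, h⟩⟩)
    let C : Finset K := Finset.univ.filter fun x => ∃ h : ∀ y ∈ X, some x ≠ some y,
      (⟨some x, h⟩ : I) ∈ s
    have hdisj : Disjoint X C := by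
      rw [Finset.disjoint_left]
      intro x hx hxC
      obtain ⟨h, -⟩ := (Finset.mem_filter.1 hxC).2
      exact h x hx rfl
    have hXC : (X ∪ C).card = X.card + C.card := Finset.card_union_of_disjoint hdisj
    have hXCle : (X ∪ C).card ≤ Fintype.card K := Finset.card_le_univ _
    let ν : I := ⟨none, by simp⟩
    have hs : s ⊆ insert ν (C.attach.image fun x =>
        (⟨some x.1, (Finset.mem_filter.1 x.2).2.1⟩ : I)) := by
      rintro ⟨c, hc⟩ hcs
      cases c with
      | none => exact Finset.mem_insert_self _ _
      | some x =>
        refine Finset.mem_insert_of_mem (Finset.mem_image.2 ⟨⟨x, ?_⟩, Finset.mem_attach _ _, rfl⟩)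
        exact Finset.mem_filter.2 ⟨Finset.mem_univ _, hc, hcs⟩
    have himg : (C.attach.image fun x =>
        (⟨some x.1, (Finset.mem_filter.1 x.2).2.1⟩ : I)).card ≤ C.card :=
      Finset.card_image_le.trans Finset.card_attach.le
    have hCav : ∀ p ∈ A \ B, ∀ Z, X ⊆ Z → ∀ x ∈ X ∪ C, ¬ R p Z (some x) := by
      intro p hp Z hZ x hx
      rcases Finset.mem_union.1 hx with hx | hx
      · exact havoid p (Finset.mem_sdiff.1 hp).1 Z hZ x hx
      · obtain ⟨h1, h2⟩ := (Finset.mem_filter.1 hx).2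
        exact hav p hp Z hZ _ h2
    -- With the view `X ∪ C` some colour must be taken, and every colour in the view is avoided.
    have hnon : ∀ p ∈ A \ B, (X ∪ C).Nonempty → R p (X ∪ C) none := by
      intro p hp hne
      obtain ⟨c, hc⟩ := htot p (X ∪ C) hne
      cases c with
      | none => exact hc
      | some x =>
        exact absurd hc (hCav p hp _ Finset.subset_union_left x (hmem p _ x hc))
    by_cases hν : ν ∈ s
    · have hcs : s.card ≤ C.card + 1 :=
        (Finset.card_le_card hs).trans ((Finset.card_insert_le _ _).trans (by omega))
      obtain ⟨p, hp⟩ := Finset.card_pos.1 (show 0 < (A \ B).card by omega)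
      by_cases hne : (X ∪ C).Nonempty
      · exact hav p hp _ Finset.subset_union_left ν hν (hnon p hp hne)
      · have hC : C.card = 0 := by
          rw [Finset.not_nonempty_iff_eq_empty.1 hne, Finset.card_empty] at hXC
          omega
        have hp₀B : p₀ ∈ B := Finset.mem_biUnion.2
          ⟨ν, hν, Finset.mem_filter.2 ⟨hp₀, Z₀, hZ₀, hR₀⟩⟩
        have := Finset.card_pos.2 ⟨p₀, hp₀B⟩
        omega
    · have hcs : s.card ≤ C.card := by
        refine le_trans (Finset.card_le_card fun c hc => ?_) himg
        rcases Finset.mem_insert.1 (hs hc) with rfl | h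
        · exact absurd hc hν
        · exact h
      obtain ⟨p, hp⟩ := Finset.card_pos.1 (show 0 < (A \ B).card by omega)
      -- Here `B` has fewer elements than `C`, so removing `B` is paid for by adding `C`,
      -- contradicting the maximality of `X`.
      have hgood : good (X ∪ C) := by
        refine ⟨A \ B, by omega, fun p hp Z hZ => hCav p hp Z
          (Finset.subset_union_left.trans hZ), p, hp, X ∪ C, subset_rfl, hnon p hp ?_⟩
        exact Finset.card_pos.1 (by omega)
      have := hmax _ hgood
      omega
  obtain ⟨f, hf, hfN⟩ := (Finset.all_card_le_biUnion_card_iff_exists_injective fun c : I => N c.1).1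
    hall
  have hZ : ∀ c : I, ∃ Z, X ⊆ Z ∧ R (f c) Z c.1 := fun c => (Finset.mem_filter.1 (hfN c)).2
  choose Z hZ using hZ
  refine ⟨X, fun c => if h : ∀ x ∈ X, c ≠ some x then f ⟨c, h⟩ else p₀,
    fun c => if h : ∀ x ∈ X, c ≠ some x then Z ⟨c, h⟩ else ∅, fun c hc => ?_,
    fun c c' hc hc' he => ?_⟩
  · simp only [dif_pos hc]
    exact hZ ⟨c, hc⟩
  · simp only [dif_pos hc, dif_pos hc'] at he
    exact congrArg Subtype.val (hf he)

end SetConsensus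

/-! ### Colours, and worlds built on `k` hidden chains. -/

namespace SetConsensus

variable {n d t k : ℕ}

/-- The colour of a value: itself if it is smaller than `k`, and `none` otherwise. -/
def color (k : ℕ) (v : Fin (d + 1)) : Option (Fin k) :=
  if h : (v : ℕ) < k then some ⟨v, h⟩ else none

theorem color_eq_some {v : Fin (d + 1)} {c : Fin k} : color k v = some c ↔ (v : ℕ) = c := by
  unfold color
  split_ifs with h
  · simp [Fin.ext_iff]
  · have := c.2
    simp only [false_iff]
    omega

theorem color_eq_none {v : Fin (d + 1)} : color k v = none ↔ k ≤ (v : ℕ) := by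
  unfold color
  split_ifs with h <;> simp <;> omega

/-- Correct processes do not decide on values of all `k + 1` colours. -/
theorem Protocol.Solves.not_all_colors {Q : Protocol n d} (hQ : Q.Solves k t)
    (α : Adversary n d t)
    (h : ∀ x : Option (Fin k), ∃ v, color k v = x ∧ ∃ i ∈ α.correct, ∃ m, Q.Decides α i m v) :
    False := by
  choose f hf hd using h
  have hinj : Function.Injective f := fun x y he => by rw [← hf x, ← hf y, he]
  have h1 : (Set.range f).ncard = k + 1 := by
    rw [← Set.image_univ, Set.ncard_image_of_injective _ hinj, Set.ncard_univ]
    simp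
  have h2 : (Set.range f).ncard ≤ {v | ∃ i ∈ α.correct, ∃ m, Q.Decides α i m v}.ncard :=
    Set.ncard_le_ncard (Set.range_subset_iff.2 hd) (Set.toFinite _)
  have h3 := hQ.agreement α
  omega

/-- Active processes that have seen a value smaller than `k` have decided. -/
def Protocol.DecidesLow (k t : ℕ) (Q : Protocol n d) : Prop :=
  ∀ (α : Adversary n d t) (i : Fin n) (m : ℕ), α.Active i m → α.SeesLow k m i →
    ∃ m' ≤ m, (Q.decision i (Q.state α m' i)).isSome

namespace Adversary

/-- `a l c`, for `c : Fin k`, are distinct processes hidden at time `l` from the active `⟨i, m⟩`. -/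
structure Chains (α : Adversary n d t) (m : ℕ) (i : Fin n) (a : ℕ → Fin k → Fin n) : Prop where
  active : α.Active i m
  hidden : ∀ l ≤ m, ∀ c, α.HiddenFrom m i (a l c) l
  inj : ∀ l ≤ m, Function.Injective (a l)

theorem HasHidden.exists_chains {α : Adversary n d t} {m : ℕ} {i : Fin n} (h : α.HasHidden k m i)
    (ha : α.Active i m) : ∃ a : ℕ → Fin k → Fin n, α.Chains m i a := by
  have h1 : ∀ l, ∃ f : Fin k → Fin n,
      l ≤ m → Function.Injective f ∧ ∀ c, α.HiddenFrom m i (f c) l := by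
    intro l
    by_cases hl : l ≤ m
    · obtain ⟨A, hA, hid⟩ := h l hl
      let e := (Finset.equivFinOfCardEq hA).symm
      exact ⟨fun c => (e c : Fin n), fun _ => ⟨Subtype.val_injective.comp e.injective,
        fun c => hid _ (e c).2⟩⟩
    · exact ⟨fun _ => i, fun hl' => absurd hl' hl⟩
  choose a ha' using h1
  exact ⟨a, ha, fun l hl => (ha' l hl).2, fun l hl => (ha' l hl).1⟩

namespace Chains

variable {α : Adversary n d t} {m : ℕ} {i : Fin n} {a : ℕ → Fin k → Fin n}

theorem ne (h : α.Chains m i a) {l : ℕ} (hl : l ≤ m) (c : Fin k) : a l c ≠ i :=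
  (h.hidden l hl c).ne hl

theorem eq_and_eq (h : α.Chains m i a) {l l' : ℕ} {c c' : Fin k} (hl : l ≤ m) (hl' : l' ≤ m)
    (he : a l c = a l' c') : l = l' ∧ c = c' := by
  have h1 := h.hidden l hl c
  rw [he] at h1
  obtain rfl := h1.time_eq (h.hidden l' hl' c') hl hl'
  exact ⟨rfl, h.inj l hl he⟩

/-- The messages delivered when `a l c`, for `l < m`, loses no message before round `l + 1`, in which
it reaches the processes in `ρ l c`, and then crashes unless these are all the others; no `a m c`
crashes, and the other processes behave as in `α` up to time `m`, with no crashes later. -/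
def Delivers (α : Adversary n d t) (m : ℕ) (a : ℕ → Fin k → Fin n)
    (ρ : ℕ → Fin k → Fin n → Prop) (r : ℕ) (j q : Fin n) : Prop :=
  (∃ l c, l < m ∧ j = a l c ∧ (r < l ∨ (r = l ∧ ρ l c q) ∨ ∀ q', q' ≠ j → ρ l c q')) ∨
  (∃ c, j = a m c) ∨
  (∀ l c, l ≤ m → j ≠ a l c) ∧ ((r < m ∧ α.delivered r j q) ∨ (m ≤ r ∧ α.Active j m))

variable {ρ ρ' : ℕ → Fin k → Fin n → Prop}

theorem delivers_chain (h : α.Chains m i a) {l r : ℕ} {c : Fin k} {q : Fin n} (hl : l < m) :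
    Delivers α m a ρ r (a l c) q ↔
      r < l ∨ (r = l ∧ ρ l c q) ∨ ∀ q', q' ≠ a l c → ρ l c q' := by
  constructor
  · rintro (⟨l', c', hl', he, h1⟩ | ⟨c', he⟩ | ⟨hn, -⟩)
    · obtain ⟨rfl, rfl⟩ := h.eq_and_eq hl.le hl'.le he
      exact h1
    · exact absurd (h.eq_and_eq hl.le le_rfl he).1 hl.ne
    · exact absurd rfl (hn l c hl.le)
  · exact fun h1 => Or.inl ⟨l, c, hl, rfl, h1⟩

theorem delivers_last (r : ℕ) (c : Fin k) (q : Fin n) : Delivers α m a ρ r (a m c) q :=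
  Or.inr (Or.inl ⟨c, rfl⟩)

theorem delivers_other {j : Fin n} (hj : ∀ l c, l ≤ m → j ≠ a l c) {r : ℕ} {q : Fin n} :
    Delivers α m a ρ r j q ↔ (r < m ∧ α.delivered r j q) ∨ (m ≤ r ∧ α.Active j m) := by
  constructor
  · rintro (⟨l', c', hl', he, h1⟩ | ⟨c', he⟩ | ⟨-, h1⟩)
    · exact absurd he (hj l' c' hl'.le)
    · exact absurd he (hj m c' le_rfl)
    · exact h1
  · exact fun h1 => Or.inr (Or.inr ⟨hj, h1⟩)

theorem cases_process (m : ℕ) (a : ℕ → Fin k → Fin n) (j : Fin n) :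
    (∃ l c, l < m ∧ j = a l c) ∨ (∃ c, j = a m c) ∨ ∀ l c, l ≤ m → j ≠ a l c := by
  by_cases h : ∀ l c, l ≤ m → j ≠ a l c
  · exact Or.inr (Or.inr h)
  · push Not at h
    obtain ⟨l, c, hl, rfl⟩ := h
    rcases hl.eq_or_lt with rfl | hl
    · exact Or.inr (Or.inl ⟨c, rfl⟩)
    · exact Or.inl ⟨l, c, hl, rfl⟩

/-- The adversary with initial values `inp` and deliveries `Delivers`. -/
def world (h : α.Chains m i a) (inp : Fin n → Fin (d + 1)) (ρ : ℕ → Fin k → Fin n → Prop) :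
    Adversary n d t where
  input := inp
  delivered := Delivers α m a ρ
  crash := by
    rintro j r ⟨q, hq, hd⟩ r' hr q' hq' hd'
    rcases cases_process m a j with ⟨l, c, hl, rfl⟩ | ⟨c, rfl⟩ | hj
    · rw [h.delivers_chain hl] at hd hd'
      rcases hd' with hlt | ⟨rfl, -⟩ | hall
      · exact hd (Or.inl (by omega))
      · exact hd (Or.inl hr)
      · exact hd (Or.inr (Or.inr hall))
    · exact hd (delivers_last r c q)
    · rw [delivers_other hj] at hd hd'
      push Not at hd
      rcases hd' with ⟨hr', hd'⟩ | ⟨hr', hd'⟩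
      · exact α.crash j r ⟨q, hq, hd.1 (by omega)⟩ r' hr q' hq' hd'
      · by_cases hrm : r < m
        · exact hd.1 hrm (hd' r hrm q hq)
        · exact hd.2 (by omega) hd'
  faulty_le := by
    refine (Set.ncard_le_ncard ?_ (Set.toFinite _)).trans α.faulty_le
    rintro j ⟨r, q, hq, hd⟩
    rcases cases_process m a j with ⟨l, c, hl, rfl⟩ | ⟨c, rfl⟩ | hj
    -- In `α` the hidden process `a l c` already loses its message to `i` in round `l + 1`, so
    -- crashing it costs no additional fault.
    · exact ⟨l, i, (h.ne hl.le c).symm, (h.hidden l hl.le c).not_delivered le_rfl hl⟩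
    · exact absurd (delivers_last r c q) hd
    · by_contra hc
      simp only [Set.mem_ofPred_eq, not_exists, not_and, not_not] at hc
      refine hd ((delivers_other hj).2 ?_)
      rcases lt_or_ge r m with hrm | hrm
      · exact Or.inl ⟨hrm, hc r q hq⟩
      · exact Or.inr ⟨hrm, fun s _ p hp => hc s p hp⟩

theorem delivers_congr (h : α.Chains m i a) {r : ℕ} {j q : Fin n} (hjq : j ≠ q)
    (h1 : ∀ l, l < r → ρ l = ρ' l) (h2 : ∀ c, ρ r c q ↔ ρ' r c q) :
    Delivers α m a ρ r j q ↔ Delivers α m a ρ' r j q := by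
  rcases cases_process m a j with ⟨l, c, hl, rfl⟩ | ⟨c, rfl⟩ | hj
  · rw [h.delivers_chain hl, h.delivers_chain hl]
    rcases lt_trichotomy r l with hrl | rfl | hrl
    · simp [hrl]
    · have aux : ∀ ρ : ℕ → Fin k → Fin n → Prop,
          (r < r ∨ (r = r ∧ ρ r c q) ∨ ∀ q', q' ≠ a r c → ρ r c q') ↔ ρ r c q := fun ρ =>
        ⟨by rintro (h | h | h); exacts [absurd h (lt_irrefl r), h.2, h q hjq.symm],
          fun h => Or.inr (Or.inl ⟨rfl, h⟩)⟩
      rw [aux, aux, h2]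
    · rw [h1 l hrl]
  · exact iff_of_true (delivers_last r c q) (delivers_last r c q)
  · rw [delivers_other hj, delivers_other hj]

/-- At time `s + 1` the reach sets of level `s` matter only through which chains reach `p` itself.
This allows behaviours of different processes, taken from different worlds, to be combined in one
world. -/
theorem world_state_succ_congr (h : α.Chains m i a) (P : Protocol n d) (inp : Fin n → Fin (d + 1))
    {s : ℕ} {p : Fin n} (h1 : ∀ l, l < s → ρ l = ρ' l) (h2 : ∀ c, ρ s c p ↔ ρ' s c p) :
    P.state (h.world inp ρ) (s + 1) p = P.state (h.world inp ρ') (s + 1) p := by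
  refine state_congr_of_seen P (α := h.world inp ρ) (β := h.world inp ρ') (m := s + 1) (i := p)
    (fun _ _ => rfl) (fun r j q hq hjq => ?_) (self_mem_seen _ p le_rfl)
  rcases (le_of_mem_seen hq).eq_or_lt with hr | hr
  · obtain rfl : r = s := by omega
    obtain rfl := eq_of_mem_seen_self hq
    exact h.delivers_congr hjq h1 h2
  · refine h.delivers_congr hjq (fun l hl => h1 l (by omega)) fun c => ?_
    rw [h1 r (by omega)]

theorem world_state_congr (h : α.Chains m i a) (P : Protocol n d) (inp : Fin n → Fin (d + 1))
    {s : ℕ} (p : Fin n) (h1 : ∀ l, l < s → ρ l = ρ' l) :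
    P.state (h.world inp ρ) s p = P.state (h.world inp ρ') s p := by
  cases s with
  | zero => rfl
  | succ s =>
    exact h.world_state_succ_congr P inp (fun l hl => h1 l (by omega)) fun c => by
      rw [h1 s s.lt_succ_self]

/-- At times before `l` every chain is passed on to its next process only, at time `l` it is passed
on to the processes in `τ`, and there are no crashes of later members of chains. -/
def levelRho (a : ℕ → Fin k → Fin n) (l : ℕ) (τ : Fin k → Fin n → Prop) (r : ℕ) (c : Fin k)
    (q : Fin n) : Prop :=
  (r < l ∧ q = a (r + 1) c) ∨ (r = l ∧ τ c q) ∨ l < r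

theorem levelRho_of_lt {l r : ℕ} {τ : Fin k → Fin n → Prop} (hr : r < l) :
    levelRho a l τ r = fun c q => q = a (r + 1) c := by
  funext c q
  simp [levelRho, hr, hr.ne, hr.not_gt]

theorem levelRho_self {l : ℕ} {τ : Fin k → Fin n → Prop} : levelRho a l τ l = τ := by
  funext c q
  simp [levelRho]

/-- Members of the chains at times after `l`, and `i`. -/
def Later (m : ℕ) (i : Fin n) (a : ℕ → Fin k → Fin n) (l : ℕ) (p : Fin n) : Prop :=
  p = i ∨ ∃ r c, l < r ∧ r ≤ m ∧ p = a r c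

theorem Later.ne {l r : ℕ} {p : Fin n} (hp : Later m i a l p) (h : α.Chains m i a) (hrl : r ≤ l)
    (hr : r ≤ m) (c : Fin k) : p ≠ a r c := by
  rintro rfl
  rcases hp with hp | ⟨r', c', h1, h2, he⟩
  · exact h.ne hr c hp
  · have := (h.eq_and_eq hr h2 he).1
    omega

theorem Later.mem_correct {l : ℕ} {p : Fin n} (hp : Later m i a l p) (h : α.Chains m i a)
    (inp : Fin n → Fin (d + 1)) (τ : Fin k → Fin n → Prop) :
    p ∈ (h.world inp (levelRho a l τ)).correct := by
  intro r q hq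
  rcases hp with rfl | ⟨s, c, hls, hsm, rfl⟩
  · refine (delivers_other fun l c hl => (h.ne hl c).symm).2 ?_
    rcases lt_or_ge r m with hr | hr
    · exact Or.inl ⟨hr, h.active r hr q hq⟩
    · exact Or.inr ⟨hr, h.active⟩
  · rcases hsm.eq_or_lt with rfl | hsm
    · exact delivers_last r c q
    · exact (h.delivers_chain hsm).2 (Or.inr (Or.inr fun q' _ => Or.inr (Or.inr hls)))

theorem active_chain (h : α.Chains m i a) (inp : Fin n → Fin (d + 1)) (l : ℕ) (hl : l < m)
    (c : Fin k) : (h.world inp ρ).Active (a l c) l :=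
  fun _ hr _ _ => (h.delivers_chain hl).2 (Or.inl hr)

theorem mem_correct_chain (h : α.Chains m i a) (inp : Fin n → Fin (d + 1)) {l : ℕ} (hl : l < m)
    {c : Fin k} (hc : ∀ q, ρ l c q) : a l c ∈ (h.world inp ρ).correct :=
  fun _ _ _ => (h.delivers_chain hl).2 (Or.inr (Or.inr fun q' _ => hc q'))

theorem chain_mem_seen (h : α.Chains m i a) (inp : Fin n → Fin (d + 1)) {l s : ℕ}
    {τ : Fin k → Fin n → Prop} (hs : s ≤ l) (hl : l < m) (c : Fin k) :
    (a 0 c, 0) ∈ (h.world inp (levelRho a l τ)).seen s (a s c) := by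
  induction s with
  | zero => exact self_mem_seen _ _ le_rfl
  | succ s ih =>
    refine mem_seen_succ.2 (Or.inr (Or.inr ⟨a s c, ⟨fun he => ?_, ?_⟩, ih (by omega)⟩))
    · have := (h.eq_and_eq (by omega) (by omega) he).1
      omega
    · refine (h.delivers_chain (by omega)).2 (Or.inr (Or.inl ⟨rfl, ?_⟩))
      rw [levelRho_of_lt (by omega)]

theorem seesLow_of_mem (h : α.Chains m i a) {inp : Fin n → Fin (d + 1)}
    (hin : ∀ c, (inp (a 0 c) : ℕ) = c) {l : ℕ} {τ : Fin k → Fin n → Prop} (hl : l < m) {c : Fin k}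
    {p : Fin n} (hp : p ≠ a l c) (hc : τ c p) :
    (h.world inp (levelRho a l τ)).SeesLow k (l + 1) p := by
  refine ⟨a 0 c, mem_seen_succ.2 (Or.inr (Or.inr ⟨a l c, ⟨hp.symm, ?_⟩,
    h.chain_mem_seen inp le_rfl hl c⟩)), ?_⟩
  · refine (h.delivers_chain hl).2 (Or.inr (Or.inl ⟨rfl, ?_⟩))
    rwa [levelRho_self]
  · change (inp (a 0 c) : ℕ) < k
    rw [hin]
    exact c.2

/-- The initial value of `a 0 c` has no influence outside the chain `c`. -/
theorem state_update (h : α.Chains m i a) (P : Protocol n d) (inp : Fin n → Fin (d + 1)) {l : ℕ}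
    {τ : Fin k → Fin n → Prop} (hl : l < m) (c : Fin k) (v : Fin (d + 1)) {s : ℕ} {q : Fin n}
    (hs : s ≤ l + 1) (hq : ∀ r ≤ s, r ≤ l → q ≠ a r c) (hτ : s = l + 1 → ¬ τ c q) :
    P.state (h.world (Function.update inp (a 0 c) v) (levelRho a l τ)) s q =
      P.state (h.world inp (levelRho a l τ)) s q := by
  induction s generalizing q with
  | zero =>
    simp only [Protocol.state, world, Function.update_of_ne (hq 0 le_rfl (Nat.zero_le l))]
  | succ s ih =>
    simp only [Protocol.state]
    rw [ih (by omega) (fun r hr => hq r (by omega)) (by omega)]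
    congr 1
    funext j
    by_cases hd : j ≠ q ∧ Delivers α m a (levelRho a l τ) s j q
    · have hj : ∀ r ≤ s, r ≤ l → j ≠ a r c := by
        rintro r hrs hrl rfl
        rcases (h.delivers_chain (by omega)).1 hd.2 with h1 | ⟨rfl, h1⟩ | h1
        · omega
        · rcases hrl.eq_or_lt with rfl | hrl
          · rw [levelRho_self] at h1
            exact hτ rfl h1
          · rw [levelRho_of_lt hrl] at h1
            exact hq (s + 1) le_rfl hrl h1
        · have h2 := h1 q hd.1.symm
          rcases hrl.eq_or_lt with rfl | hrl
          · rw [levelRho_self] at h2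
            exact hτ (by omega) h2
          · rw [levelRho_of_lt hrl] at h1
            exact h.ne (show r + 1 ≤ m by omega) c (h1 i (h.ne (by omega) c).symm).symm
      exact (if_pos hd).trans ((congrArg (P.send j · q) (ih (by omega) hj (by omega))).trans
        (if_pos hd).symm)
    · exact (if_neg hd).trans (if_neg hd).symm

/-! ### Induction along the chains. -/

variable {Q : Protocol n d}

/-- In all the worlds of level `l`, the process `a l c` decides on `c` at time `l`, and the later
processes are undecided then. -/
def Invariant (h : α.Chains m i a) (Q : Protocol n d) (inp : Fin n → Fin (d + 1)) (l : ℕ) : Prop :=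
  ∀ τ, (∀ c, Q.Decides (h.world inp (levelRho a l τ)) (a l c) l (inp (a 0 c))) ∧
    ∀ p, Later m i a l p → ∀ s ≤ l,
      Q.decision p (Q.state (h.world inp (levelRho a l τ)) s p) = none

section
variable {inp : Fin n → Fin (d + 1)} {l : ℕ}

theorem Invariant.decides (h : α.Chains m i a) {τ : Fin k → Fin n → Prop}
    (hV : h.Invariant Q inp l) {p : Fin n} (hp : Later m i a l p) {v : Fin (d + 1)}
    (hv : Q.decision p (Q.state (h.world inp (levelRho a l τ)) (l + 1) p) = some v) :
    Q.Decides (h.world inp (levelRho a l τ)) p (l + 1) v :=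
  ⟨active_of_mem_correct (hp.mem_correct h inp τ) _, hv, fun s hs => (hV τ).2 p hp s (by omega)⟩

/-- A later process decides at time `l + 1` only on low values that it has seen. -/
theorem Invariant.mem_of_decision (h : α.Chains m i a) (hQ : Q.Solves k t) (hkd : k ≤ d)
    {τ : Fin k → Fin n → Prop} (hin : ∀ c, (inp (a 0 c) : ℕ) = c)
    (hin' : ∀ j, (∀ c, j ≠ a 0 c) → k ≤ (inp j : ℕ))
    (hV : h.Invariant Q inp l) (hl : l < m) {p : Fin n} (hp : Later m i a l p) {v : Fin (d + 1)}
    (hv : Q.decision p (Q.state (h.world inp (levelRho a l τ)) (l + 1) p) = some v) {c : Fin k}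
    (hc : (v : ℕ) = c) : τ c p := by
  by_contra hτ
  have hne : ∀ r, r ≤ l → p ≠ a r c := fun r hr => hp.ne h hr (by omega) c
  -- Overwriting the input of `a 0 c` by `d` removes `c` from the inputs, since `c < k ≤ d`, but
  -- leaves the state of `p` unchanged; deciding on `c` would violate validity.
  obtain ⟨j, hj⟩ := hQ.validity
    (h.world (Function.update inp (a 0 c) (Fin.last d)) (levelRho a l τ)) p (l + 1) v
    ⟨active_of_mem_correct (hp.mem_correct h _ τ) _, by
      rwa [h.state_update Q inp hl c _ le_rfl (fun r _ hr => hne r hr) fun _ => hτ],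
      fun s hs => by
        rw [h.state_update Q inp hl c _ hs.le (fun r _ hr => hne r hr) fun he => by omega]
        exact (hV τ).2 p hp s (by omega)⟩
  change Function.update inp (a 0 c) (Fin.last d) j = v at hj
  by_cases hjc : j = a 0 c
  · rw [hjc, Function.update_self] at hj
    have := c.2
    rw [← hj, Fin.val_last] at hc
    omega
  · rw [Function.update_of_ne hjc] at hj
    by_cases hj' : ∀ c, j ≠ a 0 c
    · have h1 := hin' j hj'
      have := c.2
      rw [hj] at h1
      omega
    · push Not at hj'
      obtain ⟨c', rfl⟩ := hj'
      have h1 := hin c'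
      rw [hj, hc] at h1
      exact hjc (by rw [Fin.ext h1])

theorem Invariant.exists_decision (hlow : Q.DecidesLow k t) (h : α.Chains m i a)
    {τ : Fin k → Fin n → Prop} (hin : ∀ c, (inp (a 0 c) : ℕ) = c)
    (hV : h.Invariant Q inp l) (hl : l < m) {p : Fin n} (hp : Later m i a l p) {c : Fin k}
    (hc : τ c p) :
    ∃ v, Q.decision p (Q.state (h.world inp (levelRho a l τ)) (l + 1) p) = some v := by
  obtain ⟨s, hs, h1⟩ := hlow _ p (l + 1)
    (active_of_mem_correct (hp.mem_correct h inp τ) _)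
    (h.seesLow_of_mem hin hl (hp.ne h le_rfl hl.le c) hc)
  rcases hs.eq_or_lt with rfl | hs
  · exact Option.isSome_iff_exists.1 h1
  · rw [(hV τ).2 p hp s (by omega)] at h1
    simp at h1

/-- A later process that decides at time `l + 1` decides on a low value. -/
theorem Invariant.decision_lt (hlow : Q.DecidesLow k t) (h : α.Chains m i a) (hQ : Q.Solves k t)
    (hkd : k ≤ d)
    {τ : Fin k → Fin n → Prop} (hin : ∀ c, (inp (a 0 c) : ℕ) = c)
    (hin' : ∀ j, (∀ c, j ≠ a 0 c) → k ≤ (inp j : ℕ))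
    (hV : h.Invariant Q inp l) (hl : l < m) {p : Fin n} (hp : Later m i a l p) {v : Fin (d + 1)}
    (hv : Q.decision p (Q.state (h.world inp (levelRho a l τ)) (l + 1) p) = some v) :
    (v : ℕ) < k := by
  classical
  by_contra hkv
  have hcongr : ∀ (τ τ' : Fin k → Fin n → Prop) (p : Fin n), (∀ c, τ c p ↔ τ' c p) →
      Q.state (h.world inp (levelRho a l τ)) (l + 1) p =
        Q.state (h.world inp (levelRho a l τ')) (l + 1) p := fun τ τ' p he =>
    h.world_state_succ_congr Q inp
      (fun r hr => by rw [levelRho_of_lt hr, levelRho_of_lt hr])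
      (by simpa only [levelRho_self] using he)
  have hfin : Fintype {p // Later m i a l p} := Fintype.ofFinite _
  -- The view of a later process is the set of chains that reach it, and its colour is that of its
  -- decision. The process `i` and the `k` chain members at time `l + 1` are the `k + 1` processes
  -- needed.
  let R : {p // Later m i a l p} → Finset (Fin k) → Option (Fin k) → Prop := fun p Z x =>
    ∃ v, Q.decision p.1
      (Q.state (h.world inp (levelRho a l fun c _ => c ∈ Z)) (l + 1) p.1) = some v ∧
        color k v = x
  have hcard : Fintype.card (Fin k) + 1 ≤ Fintype.card {p // Later m i a l p} := by
    have hinj : Function.Injective fun x : Option (Fin k) => (x.elim ⟨i, Or.inl rfl⟩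
        fun c => ⟨a (l + 1) c, Or.inr ⟨l + 1, c, l.lt_succ_self, hl, rfl⟩⟩ :
          {p // Later m i a l p}) := by
      rintro (_ | c) (_ | c') he
      · rfl
      · exact absurd (congrArg Subtype.val he).symm (h.ne hl c')
      · exact absurd (congrArg Subtype.val he) (h.ne hl c)
      · exact congrArg some (h.inj (l + 1) hl (congrArg Subtype.val he))
    simpa using Fintype.card_le_of_injective _ hinj
  have hmem : ∀ p Z c, R p Z (some c) → c ∈ Z := by
    rintro p Z c ⟨v, hv, hvc⟩
    exact hV.mem_of_decision h hQ hkd hin hin' hl p.2 hv (color_eq_some.1 hvc)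
  have htot : ∀ p Z, Z.Nonempty → ∃ c, R p Z c := by
    rintro p Z ⟨c, hc⟩
    obtain ⟨v, hv⟩ := hV.exists_decision hlow h (τ := fun c _ => c ∈ Z) hin hl p.2 hc
    exact ⟨_, v, hv, rfl⟩
  have hnone : ∃ p Z, R p Z none := by
    refine ⟨⟨p, hp⟩, Finset.univ.filter fun c => τ c p, v, ?_, color_eq_none.2 (by omega)⟩
    rw [← hv]
    simp only
    rw [hcongr _ τ p (by simp)]
  obtain ⟨X, q, Z, hXZ, hinj⟩ := exists_rainbow R hcard hmem htot hnone
  -- The chains in `X` reach everybody, so their ends `a l c` are correct and contribute the colours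
  -- in `X`. Each `q x` is reached by exactly the chains in `Z x` and contributes the colour `x`
  -- outside `X`.
  let τ' : Fin k → Fin n → Prop := fun c r =>
    c ∈ X ∨ ∃ x, (∀ y ∈ X, x ≠ some y) ∧ r = (q x).1 ∧ c ∈ Z x
  refine hQ.not_all_colors (h.world inp (levelRho a l τ')) fun x => ?_
  by_cases hx : ∀ y ∈ X, x ≠ some y
  · obtain ⟨hX, v, hv, hvx⟩ := hXZ x hx
    refine ⟨v, hvx, (q x).1, (q x).2.mem_correct h inp τ', l + 1, hV.decides h (q x).2 ?_⟩
    rw [← hv, hcongr τ' (fun c _ => c ∈ Z x)]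
    intro c
    constructor
    · rintro (h1 | ⟨x', h1, h2, h3⟩)
      · exact hX h1
      · rwa [hinj x x' hx h1 (Subtype.ext h2)]
    · exact fun h1 => Or.inr ⟨x, hx, rfl, h1⟩
  · push Not at hx
    obtain ⟨c, hc, rfl⟩ := hx
    refine ⟨inp (a 0 c), color_eq_some.2 (hin c), a l c, h.mem_correct_chain inp hl ?_, l,
      (hV τ').1 c⟩
    rw [levelRho_self]
    exact fun _ => Or.inl hc

/-- Any decision is low by `decision_lt` and belongs to a chain reaching `p` by `mem_of_decision`;
with a single such chain there is no choice. -/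
theorem Invariant.decides_of_forall_iff (hlow : Q.DecidesLow k t) (h : α.Chains m i a)
    (hQ : Q.Solves k t) (hkd : k ≤ d)
    {τ : Fin k → Fin n → Prop} (hin : ∀ c, (inp (a 0 c) : ℕ) = c)
    (hin' : ∀ j, (∀ c, j ≠ a 0 c) → k ≤ (inp j : ℕ))
    (hV : h.Invariant Q inp l) (hl : l < m) {p : Fin n} (hp : Later m i a l p) {c : Fin k}
    (hc : ∀ c', τ c' p ↔ c' = c) :
    Q.Decides (h.world inp (levelRho a l τ)) p (l + 1) (inp (a 0 c)) := by
  obtain ⟨v, hv⟩ := hV.exists_decision hlow h hin hl hp ((hc c).2 rfl)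
  have hvk := hV.decision_lt hlow h hQ hkd hin hin' hl hp hv
  have h1 := (hc ⟨v, hvk⟩).1 (hV.mem_of_decision h hQ hkd hin hin' hl hp hv rfl)
  have h2 : v = inp (a 0 c) := Fin.ext (by rw [hin, ← h1])
  rw [← h2]
  exact hV.decides h hp hv

theorem Invariant.undecided_of_forall_not (hlow : Q.DecidesLow k t) (h : α.Chains m i a)
    (hQ : Q.Solves k t) (hkd : k ≤ d)
    {τ : Fin k → Fin n → Prop} (hin : ∀ c, (inp (a 0 c) : ℕ) = c)
    (hin' : ∀ j, (∀ c, j ≠ a 0 c) → k ≤ (inp j : ℕ))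
    (hV : h.Invariant Q inp l) (hl : l < m) {p : Fin n} (hp : Later m i a l p)
    (hc : ∀ c, ¬ τ c p) {s : ℕ} (hs : s ≤ l + 1) :
    Q.decision p (Q.state (h.world inp (levelRho a l τ)) s p) = none := by
  rcases hs.eq_or_lt with rfl | hs
  · rw [Option.eq_none_iff_forall_ne_some]
    intro v hv
    have hvk := hV.decision_lt hlow h hQ hkd hin hin' hl hp hv
    exact hc ⟨v, hvk⟩ (hV.mem_of_decision h hQ hkd hin hin' hl hp hv rfl)
  · exact (hV τ).2 p hp s (by omega)

theorem Invariant.succ (hlow : Q.DecidesLow k t) (h : α.Chains m i a)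
    (hQ : Q.Solves k t) (hkd : k ≤ d)
    (hin : ∀ c, (inp (a 0 c) : ℕ) = c)
    (hin' : ∀ j, (∀ c, j ≠ a 0 c) → k ≤ (inp j : ℕ))
    (hV : h.Invariant Q inp l) (hl : l + 1 < m) : h.Invariant Q inp (l + 1) := by
  intro τ
  -- Up to time `l + 1` a world of level `l + 1` is the world of level `l` in which each chain goes
  -- to its successor only.
  let τ' : Fin k → Fin n → Prop := fun c q => q = a (l + 1) c
  have hst : ∀ s ≤ l + 1, ∀ p, Q.state (h.world inp (levelRho a (l + 1) τ)) s p =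
      Q.state (h.world inp (levelRho a l τ')) s p := by
    intro s hs p
    refine h.world_state_congr Q inp p fun r hr => ?_
    rw [levelRho_of_lt (by omega)]
    rcases (show r ≤ l by omega).eq_or_lt with rfl | hr
    · rw [levelRho_self]
    · rw [levelRho_of_lt hr]
  constructor
  · intro c
    obtain ⟨-, h2, h3⟩ := hV.decides_of_forall_iff hlow h hQ hkd (τ := τ') (c := c) hin hin'
      (by omega) (p := a (l + 1) c) (Or.inr ⟨l + 1, c, by omega, hl.le, rfl⟩)
      fun c' => ⟨fun he => (h.inj _ hl.le he).symm, fun he => by rw [he]⟩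
    refine ⟨h.active_chain inp (l + 1) hl c, ?_, fun s hs => ?_⟩
    · rwa [hst _ le_rfl]
    · rw [hst s hs.le]
      exact h3 s hs
  · intro p hp s hs
    rw [hst s hs]
    refine hV.undecided_of_forall_not hlow h hQ hkd hin hin' (by omega) ?_
      (fun c hc => hp.ne h le_rfl hl.le c hc) hs
    rcases hp with hp | ⟨r, c, h1, h2, h3⟩
    · exact Or.inl hp
    · exact Or.inr ⟨r, c, by omega, h2, h3⟩

end

end Chains

end Adversary

end SetConsensus

/-! ### The base case at time `0`, and unbeatability. -/

namespace SetConsensus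

variable {n d t k : ℕ} {Q : Protocol n d}

/-- At time `0` a process that decides decides on its own initial value. -/
theorem Protocol.Solves.eq_input_of_decision (hQ : Q.Solves k t) {i : Fin n} {u v : Fin (d + 1)}
    (h : Q.decision i (Q.init i u) = some v) : v = u := by
  obtain ⟨j, hj⟩ := hQ.validity (Adversary.failureFree n d t fun _ => u) i 0 v
    ⟨Adversary.active_failureFree _ i 0, h, by simp⟩
  exact hj.symm

theorem Protocol.DecidesLow.decision_init (hlow : Q.DecidesLow k t) (hQ : Q.Solves k t) (i : Fin n)
    {u : Fin (d + 1)} (hu : (u : ℕ) < k) : Q.decision i (Q.init i u) = some u := by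
  obtain ⟨s, hs, h⟩ := hlow (Adversary.failureFree n d t fun _ => u) i 0
    (Adversary.active_failureFree _ i 0) ⟨i, Adversary.self_mem_seen _ i le_rfl, hu⟩
  obtain rfl : s = 0 := by omega
  obtain ⟨v, hv⟩ := Option.isSome_iff_exists.1 h
  have h1 : Q.decision i (Q.init i u) = some v := hv
  rw [h1, hQ.eq_input_of_decision h1]

/-- In the failure-free run each `f c` decides on `c` at time `0`; if `p` decided too, it would do
so on its own value, adding the colour `none`. -/
theorem Protocol.DecidesLow.decision_init_eq_none (hlow : Q.DecidesLow k t) (hQ : Q.Solves k t)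
    {f : Fin k → Fin n} {inp : Fin n → Fin (d + 1)} (hin : ∀ c, (inp (f c) : ℕ) = c)
    {p : Fin n} (hp : k ≤ (inp p : ℕ)) : Q.decision p (Q.init p (inp p)) = none := by
  rw [Option.eq_none_iff_forall_ne_some]
  intro v hv
  have hvp := hQ.eq_input_of_decision hv
  refine hQ.not_all_colors (Adversary.failureFree n d t inp) fun x => ?_
  cases x with
  | none =>
    exact ⟨v, color_eq_none.2 (hvp ▸ hp), p, Adversary.mem_correct_failureFree _ p, 0,
      Adversary.active_failureFree _ p 0, hv, by simp⟩
  | some c =>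
    exact ⟨inp (f c), color_eq_some.2 (hin c), f c, Adversary.mem_correct_failureFree _ _, 0,
      Adversary.active_failureFree _ _ 0,
      hlow.decision_init hQ (f c) ((hin c).trans_lt c.2), by simp⟩

namespace Adversary.Chains

variable {α : Adversary n d t} {m : ℕ} {i : Fin n} {a : ℕ → Fin k → Fin n}
  {inp : Fin n → Fin (d + 1)}

theorem invariant_zero (h : α.Chains m i a) (hlow : Q.DecidesLow k t) (hQ : Q.Solves k t)
    (hin : ∀ c, (inp (a 0 c) : ℕ) = c) (hin' : ∀ j, (∀ c, j ≠ a 0 c) → k ≤ (inp j : ℕ))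
    (hm : 0 < m) : h.Invariant Q inp 0 := by
  intro τ
  refine ⟨fun c => ⟨h.active_chain inp 0 hm c,
    hlow.decision_init hQ (a 0 c) ((hin c).trans_lt c.2), by simp⟩, fun p hp s hs => ?_⟩
  obtain rfl : s = 0 := by omega
  exact hlow.decision_init_eq_none hQ hin (hin' p fun c => hp.ne h le_rfl (Nat.zero_le m) c)

theorem invariant (h : α.Chains m i a) (hlow : Q.DecidesLow k t) (hQ : Q.Solves k t) (hkd : k ≤ d)
    (hin : ∀ c, (inp (a 0 c) : ℕ) = c) (hin' : ∀ j, (∀ c, j ≠ a 0 c) → k ≤ (inp j : ℕ))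
    {l : ℕ} (hl : l < m) : h.Invariant Q inp l := by
  induction l with
  | zero => exact h.invariant_zero hlow hQ hin hin' hl
  | succ l ih => exact (ih (by omega)).succ hlow h hQ hkd hin hin' hl

/-- The node `⟨i, m⟩` cannot tell `α` from the world in which the chains never reach it. -/
theorem state_eq_world (P : Protocol n d) {l : ℕ} {a : ℕ → Fin k → Fin n}
    (h : α.Chains (l + 1) i a) (hinp : ∀ p, (p, 0) ∈ α.seen (l + 1) i → α.input p = inp p)
    {s : ℕ} (hs : s ≤ l + 1) :
    P.state α s i = P.state (h.world inp (levelRho a l fun _ _ => False)) s i := by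
  refine state_congr_of_seen P (α := α)
    (β := h.world inp (levelRho a l fun _ _ => False)) (m := l + 1) (i := i) hinp
    (fun r j p hp hjp => ?_) (self_mem_seen α i hs)
  change _ ↔ Delivers α (l + 1) a _ r j p
  have hr : r < l + 1 := le_of_mem_seen hp
  rcases cases_process (l + 1) a j with ⟨l', c, hl', rfl⟩ | ⟨c, rfl⟩ | hj
  · have hid := h.hidden l' hl'.le c
    rw [h.delivers_chain hl']
    rcases lt_or_ge r l' with hrl | hrl
    · exact iff_of_true ((hid.2 p r hp hrl).resolve_left hjp) (Or.inl hrl)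
    · refine iff_of_false (fun hd => hid.1 ?_) ?_
      · exact seen_subset (mem_seen_of_delivered hp hjp hd) (self_mem_seen α _ hrl)
      · rintro (h1 | ⟨rfl, h1⟩ | h1)
        · omega
        · rcases (show r ≤ l by omega).eq_or_lt with rfl | hrl'
          · rwa [levelRho_self] at h1
          · rw [levelRho_of_lt hrl'] at h1
            exact (h.hidden (r + 1) hr c).1 (h1 ▸ hp)
        · have h2 := h1 i (h.ne hl'.le c).symm
          rcases (show l' ≤ l by omega).eq_or_lt with rfl | hrl'
          · rwa [levelRho_self] at h2
          · rw [levelRho_of_lt hrl'] at h2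
            exact h.ne (show l' + 1 ≤ l + 1 by omega) c h2.symm
  · exact iff_of_true (((h.hidden (l + 1) le_rfl c).2 p r hp hr).resolve_left hjp)
      (delivers_last r c p)
  · rw [delivers_other hj]
    simp [hr, hr.not_ge]

end Adversary.Chains

/-- No decision is possible at an active node that has seen no low value and from which `k` nodes are
hidden at every time. -/
theorem Protocol.DecidesLow.undecided (hlow : Q.DecidesLow k t) (hQ : Q.Solves k t) (hkd : k ≤ d)
    {α : Adversary n d t} {i : Fin n} {m : ℕ} (ha : α.Active i m) (hr : ¬ α.Ready k m i) :
    Q.decision i (Q.state α m i) = none := by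
  classical
  simp only [Adversary.Ready, not_or, not_not] at hr
  obtain ⟨hnl, hh⟩ := hr
  obtain ⟨a, h⟩ := hh.exists_chains ha
  simp only [Adversary.SeesLow, not_exists, not_and, not_lt] at hnl
  -- The hidden processes `a 0 c` start the chains with `c`; all other inputs become at least `k`,
  -- and those seen by `⟨i, m⟩` already are, hence stay unchanged.
  let inp : Fin n → Fin (d + 1) := fun j =>
    if hj : ∃ c, j = a 0 c then Fin.castLE (by omega) hj.choose
    else if k ≤ (α.input j : ℕ) then α.input j else Fin.last d
  have hin : ∀ c, (inp (a 0 c) : ℕ) = c := by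
    intro c
    have hj : ∃ c', a 0 c = a 0 c' := ⟨c, rfl⟩
    simp only [inp, dif_pos hj, Fin.val_castLE]
    rw [← h.inj 0 (Nat.zero_le m) hj.choose_spec]
  have hin' : ∀ j, (∀ c, j ≠ a 0 c) → k ≤ (inp j : ℕ) := by
    intro j hj
    have hj' : ¬ ∃ c, j = a 0 c := by simpa using hj
    simp only [inp, dif_neg hj']
    split_ifs with h1
    · exact h1
    · simpa using hkd
  have hinp : ∀ p, (p, 0) ∈ α.seen m i → α.input p = inp p := by
    intro p hp
    have hj' : ¬ ∃ c, p = a 0 c := by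
      rintro ⟨c, rfl⟩
      exact (h.hidden 0 (Nat.zero_le m) c).1 hp
    simp only [inp, dif_neg hj', if_pos (hnl p hp)]
  cases m with
  | zero =>
    have h1 := hinp i (α.self_mem_seen i le_rfl)
    change Q.decision i (Q.init i (α.input i)) = none
    rw [h1]
    exact hlow.decision_init_eq_none hQ hin (h1 ▸ hnl i (α.self_mem_seen i le_rfl))
  | succ l =>
    rw [h.state_eq_world Q hinp le_rfl]
    exact (h.invariant hlow hQ hkd hin hin' l.lt_succ_self).undecided_of_forall_not hlow h hQ hkd
      hin hin' l.lt_succ_self (Or.inl rfl) (fun _ => id) le_rfl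

theorem optMin_lastDeciderUnbeatable (hk : 1 ≤ k) (hkd : k ≤ d)
    {S : Adversary n d t → Set (Fin n)} (hS : ∀ α, α.correct ⊆ S α) :
    Protocol.LastDeciderUnbeatable k t S (optMin n d k) := by
  refine ⟨optMin_solves hk, fun Q hQ ⟨hdom, hnot⟩ => hnot fun α M hM m ⟨i, hi, v, hd⟩ => ?_⟩
  have hlow : Q.DecidesLow k t := fun α i m ha hl =>
    exists_decision_of_ready hS hk hQ hdom ha (Or.inl hl)
  obtain ⟨ha, ⟨hr, -⟩, hbefore⟩ := optMin_decides.1 hd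
  obtain ⟨m', hm', u, hu⟩ := decides_of_exists_isSome ha
    (exists_decision_of_ready hS hk hQ hdom ha hr)
  -- At a time before `m` the process is not ready under `optMin`, hence undecided under `Q`; so
  -- both protocols decide at `m`.
  rcases hm'.eq_or_lt with rfl | hlt
  · exact hM.2 ⟨i, hi, u, hu⟩
  · have := hlow.undecided hQ hkd hu.1 (hbefore m' hlt)
    rw [hu.2.1] at this
    simp at this

end SetConsensus

theorem mainTheorem5 (n k d t : ℕ) (hn : 2 ≤ n) (hk : 1 ≤ k) (hd : k ≤ d) (ht : t ≤ n - 1) :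
    SetConsensus.Protocol.LastDeciderUnbeatable k t
      (fun _ : SetConsensus.Adversary n d t => Set.univ) (SetConsensus.optMin n d k) ∧
    SetConsensus.Protocol.LastDeciderUnbeatable k t
      (fun α : SetConsensus.Adversary n d t => α.correct) (SetConsensus.optMin n d k) :=
  ⟨SetConsensus.optMin_lastDeciderUnbeatable hk hd fun _ => Set.subset_univ _,
    SetConsensus.optMin_lastDeciderUnbeatable hk hd fun _ => subset_rfl⟩
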